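/- Let $\mathcal X,\mathcal Y$ be real Hilbert spaces, $f:\mathcal X\to\mathbb R$ a continuously differentiable convex function, $A:\mathcal X\to\mathcal Y$ a continuous linear operator with adjoint $A^T$, and $b\in\mathcal Y$. Put $\mathcal L(x,\lambda)=f(x)+\langle\lambda,Ax-b\rangle$ and assume that the set $\Omega$ of saddle points of $\mathcal L$ on $\mathcal X\times\mathcal Y$, i.e. of pairs $(\hat x,\hat\lambda)$ with $\mathcal L(\hat x,\lambda)\le\mathcal L(\hat x,\hat\lambda)\le\mathcal L(x,\hat\lambda)$ for all $(x,\lambda)$ (the primal-dual solutions of $\min f(x)$ subject to $Ax=b$), is nonempty. Let $\alpha>0$, $\theta>1/\alpha$, $0<p<1$, $c>0$, $p-1<s<1$, $t_0>0$, and let $(x,\lambda):[t_0,\infty)\to\mathcal X\times\mathcal Y$, with $x$ twice differentiable and $\lambda$ differentiable, be a solution for $t\ge t_0$ of $$\ddot x(t)+\alpha\dot x(t)+t^s\Big(\nabla_x\mathcal L(x(t),\lambda(t))+\frac{c}{t^p}x(t)\Big)=0,$$ $$\dot\lambda(t)-t^{s}\Big(\nabla_\lambda\mathcal L(x(t)+\theta\dot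 x(t),\lambda(t))-\frac{c}{t^p}\lambda(t)\Big)=0,$$ where $\nabla_x\mathcal L(x,\lambda)=\nabla f(x)+A^T\lambda$ and $\nabla_\lambda\mathcal L(x,\lambda)=Ax-b$. For $t\ge t_0$ put $\mathcal L_t(x,\lambda)=\mathcal L(x,\lambda)+\frac{c}{2t^p}(\|x\|^2-\|\lambda\|^2)$, and equip $\mathcal X\times\mathcal Y$ with the norm $\|(x,\lambda)\|=\sqrt{\|x\|^2+\|\lambda\|^2}$. Then $\Omega$ has a unique element $(x^*,\lambda^*)$ of minimum norm, $\mathcal L_t$ has a unique saddle point $(x_t,\lambda_t)$ on $\mathcal X\times\mathcal Y$ for every $t\ge t_0$, and $$\lim_{t\to+\infty}\|(x(t),\lambda(t))-(x^*,\lambda^*)\|=0.$$ Moreover, as $t\to+\infty$: (i) If $p-1<s<\frac{p-1}{2}$, then $\|x(t)-x_t\|^2$, $\|\lambda(t)-\lambda_t\|^2$ and $\|\dot x(t)\|^2$ are $\mathcal O\big(\frac1{t^{2(1+s-p)}}\big)$, and $\|Ax(t)-b\|=\mathcal O\big(\frac1{t^p}+\frac1{t^{1+s-p}}\big)$. If moreover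 $\frac{2p-2}{3}<s<\frac{p-1}{2}$, then $\mathcal L_t(x(t),\lambda_t)-\mathcal L_t(x_t,\lambda_t)=\mathcal O\big(\frac1{t^{3s-2p+2}}\big)$, and $\mathcal L(x(t),\lambda^*)-\mathcal L(x^*,\lambda^*)$ and $|f(x(t))-f(x^*)|$ are $\mathcal O\big(\frac1{t^p}+\frac1{t^{3s-2p+2}}\big)$. (ii) If $\frac{p-1}{2}\le s<1$ and $r=\max\{0,p-s\}$, then $\mathcal L_t(x(t),\lambda_t)-\mathcal L_t(x_t,\lambda_t)=\mathcal O\big(\frac1{t^{1-r}}\big)$; $\|x(t)-x_t\|^2$, $\|\lambda(t)-\lambda_t\|^2$ and $\|\dot x(t)\|^2$ are $\mathcal O\big(\frac1{t^{1-s-r}}\big)$; and $\mathcal L(x(t),\lambda^*)-\mathcal L(x^*,\lambda^*)$, $|f(x(t))-f(x^*)|$ and $\|Ax(t)-b\|$ are $\mathcal O\big(\frac1{t^p}+\frac1{t^{(1-s-r)/2}}\big)$. (iii) If $0<s\le p$, then $\mathcal L(x(t),\lambda^*)-\mathcal L(x^*,\lambda^*)$, $|f(x(t))-f(x^*)|$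 and $\|Ax(t)-b\|$ are $\mathcal O\big(\frac1{t^{s}}\big)$. -/

import Mathlib

open Set Filter Topology Asymptotics

section TikhonovPrimalDual

variable {X Y : Type*}
  [NormedAddCommGroup X] [InnerProductSpace ℝ X] [CompleteSpace X]
  [NormedAddCommGroup Y] [InnerProductSpace ℝ Y] [CompleteSpace Y]

/-- The Lagrangian `L(x, l) = f(x) + ⟨l, A x - b⟩` of the problem `min f(x)` subject to
`A x = b`. -/
noncomputable def lagrangian (f : X → ℝ) (A : X →L[ℝ] Y) (b : Y) (x : X) (l : Y) : ℝ :=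
  f x + inner ℝ l (A x - b)

/-- The primal-dual solution set `Ω`: all saddle points of the Lagrangian on `X × Y`.
(On the whole space, Mathlib's `∀ x y, L a y ≤ L x b` amounts to
`L a y ≤ L a b ≤ L x b` for all `x` and `y`.) -/
def primalDualSolutions (f : X → ℝ) (A : X →L[ℝ] Y) (b : Y) : Set (X × Y) :=
  {z | IsSaddlePointOn univ univ (lagrangian f A b) z.1 z.2}

/-- The norm `√(‖x‖² + ‖l‖²)` of the Hilbert product `X × Y`. -/
noncomputable def pairNorm (z : X × Y) : ℝ := ‖WithLp.toLp 2 z‖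

/-- `z` is an element of `S` of minimum norm. -/
def IsMinNormElement (S : Set (X × Y)) (z : X × Y) : Prop :=
  z ∈ S ∧ ∀ w ∈ S, pairNorm z ≤ pairNorm w

/-- The regularized Lagrangian
`L_t(x, l) = L(x, l) + c / (2 t ^ p) * (‖x‖² - ‖l‖²)`. -/
noncomputable def regLagrangian (f : X → ℝ) (A : X →L[ℝ] Y) (b : Y) (c p t : ℝ)
    (x : X) (l : Y) : ℝ :=
  lagrangian f A b x l + c / (2 * t ^ p) * (‖x‖ ^ 2 - ‖l‖ ^ 2)

/-- The velocity of a curve defined on `[t₀, ∞)` (one-sided at `t₀`). -/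
noncomputable def velocity (t₀ : ℝ) (x : ℝ → X) (t : ℝ) : X := derivWithin x (Ici t₀) t

/-- `(x, l)` is a (classical, global) solution on `[t₀, ∞)` of the Tikhonov regularized inertial
primal-dual system with damping `α / t ^ q`:
`x'' + (α / t ^ q) x' + t ^ s (∇ₓ L(x, l) + (c / t ^ p) x) = 0`,
`l' - t ^ (q + s) (∇ₗ L(x + θ t ^ q x', l) - (c / t ^ p) l) = 0`.
Only the values of `x` and `l` on `[t₀, ∞)` matter. -/
structure IsTrajectory (f : X → ℝ) (A : X →L[ℝ] Y) (b : Y) (α θ q p c s t₀ : ℝ)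
    (x : ℝ → X) (l : ℝ → Y) : Prop where
  differentiable_x : DifferentiableOn ℝ x (Ici t₀)
  differentiable_velocity : DifferentiableOn ℝ (velocity t₀ x) (Ici t₀)
  differentiable_l : DifferentiableOn ℝ l (Ici t₀)
  primal_eq : ∀ t ∈ Ici t₀,
    velocity t₀ (velocity t₀ x) t + (α / t ^ q) • velocity t₀ x t
      + t ^ s • (gradient (fun y : X => lagrangian f A b y (l t)) (x t) + (c / t ^ p) • x t) = 0
  dual_eq : ∀ t ∈ Ici t₀,
    velocity t₀ l t
      - t ^ (q + s) •
        (gradient (fun m : Y => lagrangian f A b (x t + (θ * t ^ q) • velocity t₀ x t) m) (l t)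
          - (c / t ^ p) • l t) = 0

end TikhonovPrimalDual

/-! The saddle point z_t = (x_t, λ_t) of L_t is the zero of M + (c/t^p) id, where M(x, λ) = (∇f(x) +
Aᵀλ, b - Ax) is a continuous monotone operator whose zeros form Ω. Comparing regularized zeros for
two weights by monotonicity alone shows that z_t is bounded, moves with speed O(1/t) and converges
strongly to the minimum norm zero (`exists_tendsto_regularized_zeros`, `exists_saddle_path_bound`).
It remains to measure how well the trajectory tracks z_t.

The measure is `lyapunovEnergy`. With the reference point frozen, every cross term of its derivative
cancels: the extrapolation x + θx' in the dual equation matches the weight 1/θ in the energy, and κ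
= (α - 1/θ)/θ removes ⟨x - x_t, x'⟩. What is left is dissipation: the gap, ‖x'‖², and (c/t^p) t^s
times the squared distances (`lyapunovEnergy_deriv_le`). Moving the reference point costs O(1/t)
times quantities linear in the distances (`lyapunovEnergy_move_le`), which Young's inequality
absorbs (`energy_rate_le`). Since z_t is only known to be Lipschitz, the outcome is a Dini
inequality E' ≤ -K t^(-r) E + C t^(-σ) with max(0, p - s) ≤ r < 1, and a power barrier turns it into
E = O(t^(r-σ)) (`exists_eventually_le_rpow_of_slope`).

The admissible σ are bounded by 1 + p - s (decay of the weight) and by 2 - p - s and 2 + s - p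
(motion of z_t). Taking σ = 2 + s - p or σ = 1 - s, which cross at s = (p - 1)/2, gives (i) and
(ii), and the convergence. For (iii), Ax - b - θ⁻¹ t^(-s) λ solves a linear equation with constant
damping and O(t^(-s)) forcing, because the combination eliminates the velocity. -/

set_option linter.unusedSectionVars false

/-! ### Gradients of convex functions and existence of minimizers. -/

section ConvexGradient

variable {X : Type*} [NormedAddCommGroup X] [InnerProductSpace ℝ X] [CompleteSpace X]

theorem ConvexOn.add_inner_gradient_le {f : X → ℝ} (hconv : ConvexOn ℝ univ f)
    (hf : Differentiable ℝ f) (x y : X) : f x + inner ℝ (gradient f x) (y - x) ≤ f y := by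
  have h1 : HasDerivAt (fun r : ℝ => x + r • (y - x)) (y - x) 0 := by
    simpa using ((hasDerivAt_id (0 : ℝ)).smul_const (y - x)).const_add x
  have h2 : HasFDerivAt f (fderiv ℝ f x) (x + (0 : ℝ) • (y - x)) := by
    simpa using (hf x).hasFDerivAt
  have h3 := h2.comp_hasDerivAt (0 : ℝ) h1
  have hc : ConvexOn ℝ univ (fun r : ℝ => f (x + r • (y - x))) := by
    refine ⟨convex_univ, fun a _ b _ m n hm hn hmn => ?_⟩
    have := hconv.2 (mem_univ (x + a • (y - x))) (mem_univ (x + b • (y - x))) hm hn hmn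
    convert this using 2
    simp only [smul_add, smul_smul, smul_eq_mul, add_smul]
    have : x = m • x + n • x := by rw [← add_smul, hmn, one_smul]
    nth_rewrite 1 [this]
    abel
  have h4 := hc.le_slope_of_hasDerivAt (mem_univ 0) (mem_univ 1) one_pos h3
  simp only [slope_def_field] at h4
  rw [inner_gradient_left]
  norm_num at h4
  simp only [map_sub] at h4 ⊢
  linarith

theorem ConvexOn.inner_gradient_sub_nonneg {f : X → ℝ} (hconv : ConvexOn ℝ univ f)
    (hf : Differentiable ℝ f) (x y : X) :
    0 ≤ inner ℝ (gradient f x - gradient f y) (x - y) := by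
  have h1 := hconv.add_inner_gradient_le hf x y
  have h2 := hconv.add_inner_gradient_le hf y x
  rw [← neg_sub x y, inner_neg_right] at h1
  rw [inner_sub_left]
  linarith

theorem ContDiff.continuous_gradient {f : X → ℝ} (hf : ContDiff ℝ 1 f) :
    Continuous (gradient f) :=
  (InnerProductSpace.toDual ℝ X).symm.continuous.comp (hf.continuous_fderiv one_ne_zero)

/-- A continuous function whose midpoint convexity defect is at least quadratic, and which is
bounded below, attains its infimum. -/
theorem exists_forall_le_of_midpoint {φ : X → ℝ} (hφ : Continuous φ) {m e : ℝ} (he : 0 < e)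
    (hbdd : ∀ x, m ≤ φ x)
    (hmid : ∀ x y, φ ((1 / 2 : ℝ) • (x + y)) ≤ (φ x + φ y) / 2 - e * ‖x - y‖ ^ 2) :
    ∃ x, ∀ y, φ x ≤ φ y := by
  have hb : BddBelow (range φ) := ⟨m, by rintro _ ⟨x, rfl⟩; exact hbdd x⟩
  set I := sInf (range φ) with hI
  have hIle : ∀ x, I ≤ φ x := fun x => csInf_le hb ⟨x, rfl⟩
  have hex : ∀ n : ℕ, ∃ x, φ x < I + 1 / (n + 1 : ℝ) := by
    intro n
    obtain ⟨_, ⟨x, rfl⟩, hx⟩ := exists_lt_of_csInf_lt (range_nonempty φ)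
      (show sInf (range φ) < I + 1 / (n + 1 : ℝ) by
        rw [← hI]; linarith [Nat.one_div_pos_of_nat (α := ℝ) (n := n)])
    exact ⟨x, hx⟩
  choose u hu using hex
  have hlim : Tendsto (fun n : ℕ => 1 / ((n : ℝ) + 1)) atTop (𝓝 0) :=
    tendsto_one_div_add_atTop_nhds_zero_nat
  have hcau : CauchySeq u := by
    -- The midpoint of two nearly minimal points still has value at least `I`, so the convexity
    -- defect `e * ‖u n - u k‖ ^ 2` is at most `1 / (N + 1)`.
    refine cauchySeq_of_le_tendsto_0 (fun n : ℕ => Real.sqrt ((1 / ((n : ℝ) + 1)) / e)) ?_ ?_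
    · intro n k N hn hk
      rw [dist_eq_norm]
      apply Real.le_sqrt_of_sq_le
      rw [le_div_iff₀ he]
      have h1 := hmid (u n) (u k)
      have h2 := hIle ((1 / 2 : ℝ) • (u n + u k))
      have h3 := hu n
      have h4 := hu k
      have h5 : 1 / ((n : ℝ) + 1) ≤ 1 / ((N : ℝ) + 1) := Nat.one_div_le_one_div hn
      have h6 : 1 / ((k : ℝ) + 1) ≤ 1 / ((N : ℝ) + 1) := Nat.one_div_le_one_div hk
      linarith
    · have := (hlim.div_const e).sqrt
      simpa using this
  obtain ⟨a, ha⟩ := cauchySeq_tendsto_of_complete hcau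
  refine ⟨a, fun y => le_trans ?_ (hIle y)⟩
  have h1 : Tendsto (fun n => φ (u n)) atTop (𝓝 (φ a)) := (hφ.tendsto a).comp ha
  have h2 : Tendsto (fun n : ℕ => I + 1 / ((n : ℝ) + 1)) atTop (𝓝 (I + 0)) :=
    hlim.const_add I
  rw [add_zero] at h2
  exact le_of_tendsto_of_tendsto' h1 h2 fun n => (hu n).le

end ConvexGradient

/-! ### Tikhonov regularization of monotone operators. -/

section MonotoneTikhonov

variable {H : Type*} [NormedAddCommGroup H] [InnerProductSpace ℝ H] {M : H → H}

theorem mul_norm_sub_sq_le_of_regularized_zeros (hM : ∀ z w, 0 ≤ inner ℝ (M z - M w) (z - w))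
    {e d : ℝ} {a b : H} (ha : M a + e • a = 0) (hb : M b + d • b = 0) :
    e * ‖a - b‖ ^ 2 ≤ (d - e) * inner ℝ b (a - b) := by
  have h := hM a b
  rw [eq_neg_of_add_eq_zero_left ha, eq_neg_of_add_eq_zero_left hb] at h
  have e1 : -(e • a) - -(d • b) = (d - e) • b - e • (a - b) := by module
  rw [e1, inner_sub_left, inner_smul_left, inner_smul_left, real_inner_self_eq_norm_sq] at h
  simp only [conj_trivial] at h
  linarith

/-- Monotonicity forces ⟨b, a - b⟩ ≥ 0; expand ‖b + (a - b)‖². The case `e = 0` compares a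
regularized zero with a true zero, while `e > 0` compares two points of the path. -/
theorem norm_sub_sq_le_of_regularized_zeros (hM : ∀ z w, 0 ≤ inner ℝ (M z - M w) (z - w))
    {e d : ℝ} (hed : e < d) (he : 0 ≤ e) {a b : H} (ha : M a + e • a = 0) (hb : M b + d • b = 0) :
    ‖a - b‖ ^ 2 ≤ ‖a‖ ^ 2 - ‖b‖ ^ 2 := by
  have h := mul_norm_sub_sq_le_of_regularized_zeros hM ha hb
  have h0 : 0 ≤ inner ℝ b (a - b) := by
    have : 0 ≤ (d - e) * inner ℝ b (a - b) := le_trans (by positivity) h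
    exact nonneg_of_mul_nonneg_right this (by linarith)
  have h1 : ‖a‖ ^ 2 = ‖b + (a - b)‖ ^ 2 := by congr 2; abel
  rw [norm_add_sq_real] at h1
  linarith

/-- Cauchy–Schwarz followed by division by ‖a - b‖. This is the source of the speed bound for the
path. -/
theorem mul_norm_sub_le_of_regularized_zeros (hM : ∀ z w, 0 ≤ inner ℝ (M z - M w) (z - w))
    {e d : ℝ} (hed : e < d) {a b : H} (ha : M a + e • a = 0) (hb : M b + d • b = 0) :
    e * ‖a - b‖ ≤ (d - e) * ‖b‖ := by
  have h := mul_norm_sub_sq_le_of_regularized_zeros hM ha hb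
  rcases (norm_nonneg (a - b)).eq_or_lt with h0 | h0
  · rw [← h0]
    have := norm_nonneg b
    nlinarith
  · have h2 := mul_le_mul_of_nonneg_left (real_inner_le_norm b (a - b)) (sub_pos.2 hed).le
    refine le_of_mul_le_mul_right ?_ h0
    nlinarith

theorem eq_of_regularized_zeros (hM : ∀ z w, 0 ≤ inner ℝ (M z - M w) (z - w))
    {e : ℝ} (he : 0 < e) {a b : H} (ha : M a + e • a = 0) (hb : M b + e • b = 0) : a = b := by
  have h := hM a b
  rw [eq_neg_of_add_eq_zero_left ha, eq_neg_of_add_eq_zero_left hb] at h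
  have e1 : -(e • a) - -(e • b) = - (e • (a - b)) := by module
  rw [e1, inner_neg_left, inner_smul_left, real_inner_self_eq_norm_sq] at h
  simp only [conj_trivial] at h
  have : ‖a - b‖ ^ 2 = 0 := by
    have := sq_nonneg ‖a - b‖
    nlinarith
  simpa [sub_eq_zero] using this

/-- Along a vanishing Tikhonov regularization, the regularized zeros of a continuous monotone
operator converge to its zero of minimal norm. -/
theorem exists_tendsto_regularized_zeros [CompleteSpace H] (hMc : Continuous M)
    (hM : ∀ z w, 0 ≤ inner ℝ (M z - M w) (z - w)) {w : H} (hw : M w = 0)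
    {e : ℝ → ℝ} {z : ℝ → H} {t₀ : ℝ} (hpos : ∀ t ≥ t₀, 0 < e t)
    (hanti : ∀ t ≥ t₀, ∀ r > t, e r < e t) (hlim : Tendsto e atTop (𝓝 0))
    (hz : ∀ t ≥ t₀, M (z t) + e t • z t = 0) :
    ∃ a, Tendsto z atTop (𝓝 a) ∧ M a = 0 ∧ ∀ v, M v = 0 → ‖v - a‖ ^ 2 ≤ ‖v‖ ^ 2 - ‖a‖ ^ 2 := by
  have hle : ∀ v, M v = 0 → ∀ t ≥ t₀, ‖v - z t‖ ^ 2 ≤ ‖v‖ ^ 2 - ‖z t‖ ^ 2 := fun v hv t ht =>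
    norm_sub_sq_le_of_regularized_zeros hM (hpos t ht) le_rfl (by simpa using hv) (hz t ht)
  have hstep : ∀ t ≥ t₀, ∀ r ≥ t, ‖z r - z t‖ ^ 2 ≤ ‖z r‖ ^ 2 - ‖z t‖ ^ 2 := by
    intro t ht r hr
    rcases hr.eq_or_lt with rfl | hr
    · simp
    · exact norm_sub_sq_le_of_regularized_zeros hM (hanti t ht r hr)
        (hpos r (ht.trans hr.le)).le (hz r (ht.trans hr.le)) (hz t ht)
  -- Squared norms increase along the path and stay below ‖w‖², so they converge, and by `hstep`
  -- their increments dominate squared distances. The `max` makes `N` monotone on all of ℝ.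
  set N : ℝ → ℝ := fun t => ‖z (max t t₀)‖ ^ 2 with hN
  have hmono : Monotone N := by
    intro t r htr
    have := hstep (max t t₀) (le_max_right _ _) (max r t₀) (max_le_max_right t₀ htr)
    have h0 := sq_nonneg ‖z (max r t₀) - z (max t t₀)‖
    simp only [hN]; linarith
  have hbd : BddAbove (range N) := by
    refine ⟨‖w‖ ^ 2, ?_⟩
    rintro _ ⟨t, rfl⟩
    have := hle w hw (max t t₀) (le_max_right _ _)
    have h0 := sq_nonneg ‖w - z (max t t₀)‖
    simp only [hN]; linarith
  have hNlim := tendsto_atTop_ciSup hmono hbd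
  set S := ⨆ t, N t
  have hNS : ∀ t, N t ≤ S := fun t => le_ciSup hbd t
  have hcau : CauchySeq z := by
    rw [Metric.cauchySeq_iff']
    intro η hη
    have h1 : ∀ᶠ t in atTop, S - η ^ 2 < N t :=
      hNlim.eventually (lt_mem_nhds (by have := pow_pos hη 2; linarith))
    obtain ⟨T, hT, hT0⟩ := (h1.and (eventually_ge_atTop t₀)).exists
    refine ⟨T, fun r hr => ?_⟩
    rw [dist_eq_norm]
    have h2 := hstep T hT0 r hr
    have h3 := hNS r
    simp only [hN, max_eq_left hT0, max_eq_left (hT0.trans hr)] at hT h3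
    exact lt_of_pow_lt_pow_left₀ 2 hη.le (by linarith)
  obtain ⟨a, ha⟩ := cauchySeq_tendsto_of_complete hcau
  refine ⟨a, ha, ?_, fun v hv => ?_⟩
  · have h1 : Tendsto (fun t => M (z t) + e t • z t) atTop (𝓝 (M a + (0 : ℝ) • a)) :=
      ((hMc.tendsto a).comp ha).add (hlim.smul ha)
    have h2 : Tendsto (fun t => M (z t) + e t • z t) atTop (𝓝 0) :=
      tendsto_const_nhds.congr' <| (eventually_ge_atTop t₀).mono fun t ht => (hz t ht).symm
    simpa using tendsto_nhds_unique h1 h2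
  · exact le_of_tendsto_of_tendsto ((ha.const_sub v).norm.pow 2)
      ((ha.norm.pow 2).const_sub _) ((eventually_ge_atTop t₀).mono fun t ht => hle v hv t ht)

end MonotoneTikhonov

/-! ### Saddle points of the regularized Lagrangian as regularized zeros. -/

section SaddlePoints

open ContinuousLinearMap (adjoint)

variable {X Y : Type*}
  [NormedAddCommGroup X] [InnerProductSpace ℝ X] [CompleteSpace X]
  [NormedAddCommGroup Y] [InnerProductSpace ℝ Y] [CompleteSpace Y]

/-- The Lagrangian with a Tikhonov term of weight `e`. -/
noncomputable def tikhonovLagrangian (f : X → ℝ) (A : X →L[ℝ] Y) (b : Y) (e : ℝ)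
    (x : X) (l : Y) : ℝ :=
  lagrangian f A b x l + e / 2 * (‖x‖ ^ 2 - ‖l‖ ^ 2)

theorem regLagrangian_eq (f : X → ℝ) (A : X →L[ℝ] Y) (b : Y) (c p t : ℝ) :
    regLagrangian f A b c p t = tikhonovLagrangian f A b (c / t ^ p) := by
  ext x l
  rw [regLagrangian, tikhonovLagrangian, div_div, mul_comm 2]

theorem tikhonovLagrangian_zero (f : X → ℝ) (A : X →L[ℝ] Y) (b : Y) :
    tikhonovLagrangian f A b 0 = lagrangian f A b := by
  ext x l
  simp [tikhonovLagrangian]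

variable {f : X → ℝ} {A : X →L[ℝ] Y} {b : Y}

theorem hasFDerivAt_lagrangian_left (hf : Differentiable ℝ f) (x : X) (l : Y) :
    HasFDerivAt (fun y => lagrangian f A b y l) (innerSL ℝ (gradient f x + adjoint A l)) x := by
  have h1 : HasFDerivAt f (fderiv ℝ f x) x := (hf x).hasFDerivAt
  have h2 : HasFDerivAt (fun y => inner ℝ l (A y - b)) ((innerSL ℝ l).comp A) x :=
    (innerSL ℝ l).hasFDerivAt.comp x (A.hasFDerivAt.sub_const b)
  refine (h1.add h2).congr_fderiv ?_
  ext h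
  simp [ContinuousLinearMap.adjoint_inner_left, inner_gradient_left]

theorem gradient_lagrangian_left (hf : Differentiable ℝ f) (x : X) (l : Y) :
    gradient (fun y => lagrangian f A b y l) x = gradient f x + adjoint A l :=
  (hasFDerivAt_iff_hasGradientAt.1 (hasFDerivAt_lagrangian_left hf x l)).gradient.trans <|
    (InnerProductSpace.toDual ℝ X).symm_apply_apply _

theorem hasFDerivAt_lagrangian_right (x : X) (l : Y) :
    HasFDerivAt (fun m => lagrangian f A b x m) (innerSL ℝ (A x - b)) l := by
  have h : HasFDerivAt (fun m => inner ℝ (A x - b) m) (innerSL ℝ (A x - b)) l :=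
    (innerSL ℝ (A x - b)).hasFDerivAt
  simpa [lagrangian, real_inner_comm] using h.const_add (f x)

theorem gradient_lagrangian_right (x : X) (l : Y) :
    gradient (fun m => lagrangian f A b x m) l = A x - b :=
  (hasFDerivAt_iff_hasGradientAt.1 (hasFDerivAt_lagrangian_right x l)).gradient.trans <|
    (InnerProductSpace.toDual ℝ Y).symm_apply_apply _

theorem norm_sq_add_inner_le {E : Type*} [NormedAddCommGroup E] [InnerProductSpace ℝ E] (x y : E) :
    ‖x‖ ^ 2 + 2 * inner ℝ x (y - x) ≤ ‖y‖ ^ 2 := by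
  have h : ‖y‖ ^ 2 = ‖x + (y - x)‖ ^ 2 := by congr 2; abel
  rw [h, norm_add_sq_real]
  have := sq_nonneg ‖y - x‖
  linarith

theorem norm_sq_eq_add_inner {E : Type*} [NormedAddCommGroup E] [InnerProductSpace ℝ E] (x y : E) :
    ‖y‖ ^ 2 = ‖x‖ ^ 2 + 2 * inner ℝ x (y - x) + ‖y - x‖ ^ 2 := by
  rw [← norm_add_sq_real]; congr 2; abel

/-- Strong convexity of the regularized Lagrangian in the primal variable. -/
theorem tikhonovLagrangian_ge (hf : Differentiable ℝ f) (hconv : ConvexOn ℝ univ f)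
    (e : ℝ) (x y : X) (l : Y) :
    tikhonovLagrangian f A b e x l + inner ℝ (gradient f x + adjoint A l + e • x) (y - x)
      + e / 2 * ‖y - x‖ ^ 2 ≤ tikhonovLagrangian f A b e y l := by
  have h1 := hconv.add_inner_gradient_le hf x y
  have h2 := norm_sq_eq_add_inner x y
  have h3 : (inner ℝ l (A y - b) : ℝ) = inner ℝ l (A x - b) + inner ℝ (adjoint A l) (y - x) := by
    rw [ContinuousLinearMap.adjoint_inner_left, ← inner_add_right, map_sub]
    congr 1; abel
  simp only [tikhonovLagrangian, lagrangian, inner_add_left, inner_smul_left, conj_trivial]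
  rw [h3, h2]
  linarith

theorem isSaddlePointOn_tikhonovLagrangian_iff (hf : Differentiable ℝ f)
    (hconv : ConvexOn ℝ univ f) {e : ℝ} (he : 0 ≤ e) {x : X} {l : Y} :
    IsSaddlePointOn univ univ (tikhonovLagrangian f A b e) x l ↔
      gradient f x + adjoint A l + e • x = 0 ∧ A x - b - e • l = 0 := by
  constructor
  · intro h
    constructor
    · have hmin : IsLocalMin (fun y => tikhonovLagrangian f A b e y l) x :=
        Filter.Eventually.of_forall fun y => h y (mem_univ _) l (mem_univ _)
      have hd : HasFDerivAt (fun y => tikhonovLagrangian f A b e y l)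
          (innerSL ℝ (gradient f x + adjoint A l + e • x)) x := by
        have h1 := (hasFDerivAt_lagrangian_left (A := A) (b := b) hf x l).add
          (((hasStrictFDerivAt_norm_sq x).hasFDerivAt.sub_const (‖l‖ ^ 2)).const_mul (e / 2))
        refine h1.congr_fderiv ?_
        ext h
        simp
        ring
      have h0 := hmin.hasFDerivAt_eq_zero hd
      -- The vanishing functional is evaluated at the very vector that represents it.
      exact inner_self_eq_zero.1 (show inner ℝ _ _ = (0 : ℝ) from DFunLike.congr_fun h0 _)
    · have hmax : IsLocalMax (fun m => tikhonovLagrangian f A b e x m) l :=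
        Filter.Eventually.of_forall fun y => h x (mem_univ _) y (mem_univ _)
      have hd : HasFDerivAt (fun m => tikhonovLagrangian f A b e x m)
          (innerSL ℝ (A x - b - e • l)) l := by
        have h1 := (hasFDerivAt_lagrangian_right (f := f) (A := A) (b := b) x l).add
          (((hasStrictFDerivAt_norm_sq l).hasFDerivAt.const_sub (‖x‖ ^ 2)).const_mul (e / 2))
        refine h1.congr_fderiv ?_
        ext h
        simp
        ring
      have h0 := hmax.hasFDerivAt_eq_zero hd
      exact inner_self_eq_zero.1 (show inner ℝ _ _ = (0 : ℝ) from DFunLike.congr_fun h0 _)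
  · rintro ⟨h1, h2⟩ y - m -
    have h3 := tikhonovLagrangian_ge (A := A) (b := b) hf hconv e x y l
    rw [h1, inner_zero_left] at h3
    have h4 : tikhonovLagrangian f A b e x m ≤ tikhonovLagrangian f A b e x l := by
      have h5 := norm_sq_add_inner_le l m
      have h6 : (inner ℝ m (A x - b) : ℝ) = inner ℝ l (A x - b) + e * inner ℝ l (m - l) := by
        rw [sub_eq_zero.1 h2, inner_smul_right, inner_smul_right, inner_sub_right,
          real_inner_comm m l]
        ring
      simp only [tikhonovLagrangian, lagrangian, h6]
      nlinarith
    have h7 : 0 ≤ e / 2 * ‖y - x‖ ^ 2 := by positivity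
    linarith

/-- The monotone operator `(x, l) ↦ (∇f(x) + Aᵀ l, b - A x)` of the saddle point problem. -/
noncomputable def saddleOperator (f : X → ℝ) (A : X →L[ℝ] Y) (b : Y) (z : WithLp 2 (X × Y)) :
    WithLp 2 (X × Y) :=
  WithLp.toLp 2 (gradient f z.fst + adjoint A z.snd, b - A z.fst)

theorem continuous_saddleOperator (hf : ContDiff ℝ 1 f) : Continuous (saddleOperator f A b) := by
  have h1 : Continuous fun z : WithLp 2 (X × Y) => z.fst :=
    continuous_fst.comp (WithLp.prod_continuous_ofLp 2 X Y)
  have h2 : Continuous fun z : WithLp 2 (X × Y) => z.snd :=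
    continuous_snd.comp (WithLp.prod_continuous_ofLp 2 X Y)
  exact (WithLp.prod_continuous_toLp 2 X Y).comp
    (((hf.continuous_gradient.comp h1).add ((adjoint A).continuous.comp h2)).prodMk
      (continuous_const.sub (A.continuous.comp h1)))

/-- The part of the operator coming from `A` is skew-adjoint and drops out, leaving the monotonicity
of the gradient. -/
theorem inner_saddleOperator_sub_nonneg (hf : Differentiable ℝ f) (hconv : ConvexOn ℝ univ f)
    (z w : WithLp 2 (X × Y)) :
    0 ≤ inner ℝ (saddleOperator f A b z - saddleOperator f A b w) (z - w) := by
  have h := hconv.inner_gradient_sub_nonneg hf z.fst w.fst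
  have e1 : (inner ℝ (saddleOperator f A b z - saddleOperator f A b w) (z - w) : ℝ)
      = inner ℝ (gradient f z.fst - gradient f w.fst) (z.fst - w.fst)
        + inner ℝ (adjoint A (z.snd - w.snd)) (z.fst - w.fst)
        - inner ℝ (A (z.fst - w.fst)) (z.snd - w.snd) := by
    simp only [saddleOperator, WithLp.prod_inner_apply, WithLp.ofLp_sub, Prod.fst_sub,
      Prod.snd_sub]
    rw [← inner_add_left, sub_eq_add_neg _ (inner ℝ (A _) _), ← inner_neg_left]
    congr 2
    · simp only [map_sub]; abel
    · simp only [map_sub]; abel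
  rw [e1, ContinuousLinearMap.adjoint_inner_left, real_inner_comm (A _)]
  linarith

theorem saddleOperator_add_smul_eq_zero_iff {e : ℝ} {x : X} {l : Y} :
    saddleOperator f A b (WithLp.toLp 2 (x, l)) + e • WithLp.toLp 2 (x, l) = 0 ↔
      gradient f x + adjoint A l + e • x = 0 ∧ A x - b - e • l = 0 := by
  have h : saddleOperator f A b (WithLp.toLp 2 (x, l)) + e • WithLp.toLp 2 (x, l)
      = WithLp.toLp 2 (gradient f x + adjoint A l + e • x, b - A x + e • l) := rfl
  rw [h, WithLp.toLp_eq_zero, Prod.mk_eq_zero, ← neg_eq_zero (a := b - A x + e • l)]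
  have : -(b - A x + e • l) = A x - b - e • l := by abel
  rw [this]

theorem isSaddlePointOn_iff_saddleOperator (hf : Differentiable ℝ f)
    (hconv : ConvexOn ℝ univ f) {e : ℝ} (he : 0 ≤ e) {x : X} {l : Y} :
    IsSaddlePointOn univ univ (tikhonovLagrangian f A b e) x l ↔
      saddleOperator f A b (WithLp.toLp 2 (x, l)) + e • WithLp.toLp 2 (x, l) = 0 :=
  (isSaddlePointOn_tikhonovLagrangian_iff hf hconv he).trans
    saddleOperator_add_smul_eq_zero_iff.symm

theorem mem_primalDualSolutions_iff (hf : Differentiable ℝ f) (hconv : ConvexOn ℝ univ f)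
    {z : X × Y} :
    z ∈ primalDualSolutions f A b ↔ saddleOperator f A b (WithLp.toLp 2 z) = 0 := by
  have h := isSaddlePointOn_iff_saddleOperator (A := A) (b := b) hf hconv le_rfl
    (x := z.1) (l := z.2)
  rw [tikhonovLagrangian_zero, zero_smul, add_zero] at h
  exact h

/-- The regularized Lagrangian has a saddle point: eliminate the multiplier and minimize the
resulting quadratic penalty function. -/
theorem exists_isSaddlePointOn_tikhonovLagrangian (hf : ContDiff ℝ 1 f)
    (hconv : ConvexOn ℝ univ f) {e : ℝ} (he : 0 < e) :
    ∃ z : X × Y, IsSaddlePointOn univ univ (tikhonovLagrangian f A b e) z.1 z.2 := by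
  have hfd : Differentiable ℝ f := hf.differentiable one_ne_zero
  -- For fixed `x`, the maximum of the regularized Lagrangian over the multiplier is attained at
  -- `e⁻¹ • (A x - b)` and equals `φ x`.
  set φ : X → ℝ := fun x => f x + e⁻¹ / 2 * ‖A x - b‖ ^ 2 + e / 2 * ‖x‖ ^ 2 with hφ
  have hφc : Continuous φ := by
    have := hf.continuous
    fun_prop
  have hlow : ∀ x, f 0 - ‖gradient f 0‖ ^ 2 / (2 * e) ≤ φ x := by
    intro x
    have h1 := hconv.add_inner_gradient_le hfd 0 x
    rw [sub_zero] at h1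
    have h2 := neg_le_of_abs_le (abs_real_inner_le_norm (gradient f 0) x)
    have h3 : 0 ≤ e⁻¹ / 2 * ‖A x - b‖ ^ 2 := by positivity
    have h4 : 0 ≤ (‖gradient f 0‖ - e * ‖x‖) ^ 2 / (2 * e) := by positivity
    have h5 : (‖gradient f 0‖ - e * ‖x‖) ^ 2 / (2 * e)
        = ‖gradient f 0‖ ^ 2 / (2 * e) - ‖gradient f 0‖ * ‖x‖ + e / 2 * ‖x‖ ^ 2 := by
      field_simp; ring
    simp only [hφ]
    linarith
  have hmid : ∀ x y, φ ((1 / 2 : ℝ) • (x + y)) ≤ (φ x + φ y) / 2 - e / 8 * ‖x - y‖ ^ 2 := by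
    intro x y
    have h1 := hconv.2 (mem_univ x) (mem_univ y) (show (0 : ℝ) ≤ 1 / 2 by norm_num)
      (show (0 : ℝ) ≤ 1 / 2 by norm_num) (by norm_num)
    rw [← smul_add, smul_eq_mul, smul_eq_mul] at h1
    have h2 : A ((1 / 2 : ℝ) • (x + y)) - b = (1 / 2 : ℝ) • ((A x - b) + (A y - b)) := by
      rw [map_smul, map_add]; module
    have h3 : ‖A ((1 / 2 : ℝ) • (x + y)) - b‖ ^ 2 ≤ (‖A x - b‖ ^ 2 + ‖A y - b‖ ^ 2) / 2 := by
      rw [h2, norm_smul, mul_pow]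
      have h4 := norm_add_sq_real (A x - b) (A y - b)
      have h5 := norm_sub_sq_real (A x - b) (A y - b)
      have h6 := sq_nonneg ‖A x - b - (A y - b)‖
      norm_num
      linarith
    have h4 : ‖(1 / 2 : ℝ) • (x + y)‖ ^ 2 = (‖x‖ ^ 2 + ‖y‖ ^ 2) / 2 - ‖x - y‖ ^ 2 / 4 := by
      rw [norm_smul, mul_pow, norm_add_sq_real, norm_sub_sq_real]
      norm_num
      ring
    have h5 := mul_le_mul_of_nonneg_left h3 (show 0 ≤ e⁻¹ / 2 by positivity)
    simp only [hφ, h4]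
    linarith
  obtain ⟨x, hx⟩ := exists_forall_le_of_midpoint hφc (show 0 < e / 8 by positivity) hlow hmid
  refine ⟨(x, e⁻¹ • (A x - b)),
    (isSaddlePointOn_tikhonovLagrangian_iff hfd hconv he.le).2 ⟨?_, ?_⟩⟩
  · have hmin : IsLocalMin φ x := Filter.Eventually.of_forall hx
    have hd : HasFDerivAt φ
        (innerSL ℝ (gradient f x + adjoint A (e⁻¹ • (A x - b)) + e • x)) x := by
      have h1 : HasFDerivAt f (fderiv ℝ f x) x := (hfd x).hasFDerivAt
      have h2 := (((A.hasFDerivAt (x := x)).sub_const b).norm_sq).const_mul (e⁻¹ / 2)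
      have h3 := ((hasStrictFDerivAt_norm_sq x).hasFDerivAt).const_mul (e / 2)
      refine ((h1.add h2).add h3).congr_fderiv ?_
      ext h
      simp [ContinuousLinearMap.adjoint_inner_left, inner_gradient_left]
      ring
    have h0 := hmin.hasFDerivAt_eq_zero hd
    exact inner_self_eq_zero.1 (show inner ℝ _ _ = (0 : ℝ) from DFunLike.congr_fun h0 _)
  · simp [smul_smul, he.ne']

theorem existsUnique_isSaddlePointOn_tikhonovLagrangian (hf : ContDiff ℝ 1 f)
    (hconv : ConvexOn ℝ univ f) {e : ℝ} (he : 0 < e) :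
    ∃! z : X × Y, IsSaddlePointOn univ univ (tikhonovLagrangian f A b e) z.1 z.2 := by
  have hfd : Differentiable ℝ f := hf.differentiable one_ne_zero
  refine existsUnique_of_exists_of_unique
    (exists_isSaddlePointOn_tikhonovLagrangian hf hconv he) fun z w hz hw => ?_
  rw [isSaddlePointOn_iff_saddleOperator hfd hconv he.le] at hz hw
  exact WithLp.toLp_injective 2
    (eq_of_regularized_zeros (inner_saddleOperator_sub_nonneg hfd hconv) he hz hw)

variable {c p t₀ : ℝ}

theorem tikhonov_weight_lt (hp : 0 < p) (hc : 0 < c) (ht₀ : 0 < t₀) :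
    ∀ t ≥ t₀, ∀ r > t, c / r ^ p < c / t ^ p := fun _ ht _ hr =>
  div_lt_div_of_pos_left hc (Real.rpow_pos_of_pos (ht₀.trans_le ht) p)
    (Real.rpow_lt_rpow (ht₀.trans_le ht).le hr hp)

/-- The last inequality identifies the limit: it yields both minimality of the norm and, through
`eq_of_pairNorm_sub_sq_le`, uniqueness of the minimizer. -/
theorem exists_tendsto_saddle_path (hf : ContDiff ℝ 1 f) (hconv : ConvexOn ℝ univ f)
    (hΩ : (primalDualSolutions f A b).Nonempty) (hp : 0 < p) (hc : 0 < c) (ht₀ : 0 < t₀)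
    {z : ℝ → X × Y}
    (hz : ∀ t ≥ t₀, IsSaddlePointOn univ univ (regLagrangian f A b c p t) (z t).1 (z t).2) :
    ∃ a : X × Y, Tendsto (fun t => pairNorm (z t - a)) atTop (𝓝 0) ∧
      a ∈ primalDualSolutions f A b ∧
      ∀ w ∈ primalDualSolutions f A b, pairNorm (w - a) ^ 2 ≤ pairNorm w ^ 2 - pairNorm a ^ 2 := by
  have hfd : Differentiable ℝ f := hf.differentiable one_ne_zero
  obtain ⟨w, hw⟩ := hΩ
  have hpos : ∀ t ≥ t₀, 0 < c / t ^ p := fun t ht =>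
    div_pos hc (Real.rpow_pos_of_pos (ht₀.trans_le ht) p)
  have hlim : Tendsto (fun t : ℝ => c / t ^ p) atTop (𝓝 0) :=
    (tendsto_rpow_atTop hp).const_div_atTop c
  obtain ⟨a, ha, ha0, hav⟩ := exists_tendsto_regularized_zeros (continuous_saddleOperator hf)
    (inner_saddleOperator_sub_nonneg hfd hconv) ((mem_primalDualSolutions_iff hfd hconv).1 hw)
    hpos (tikhonov_weight_lt hp hc ht₀) hlim (z := fun t => WithLp.toLp 2 (z t)) (fun t ht => by
      have := hz t ht
      rw [regLagrangian_eq, isSaddlePointOn_iff_saddleOperator hfd hconv (hpos t ht).le] at this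
      exact this)
  refine ⟨WithLp.ofLp a, ?_, (mem_primalDualSolutions_iff hfd hconv).2 ha0, fun w hw =>
    hav _ ((mem_primalDualSolutions_iff hfd hconv).1 hw)⟩
  exact tendsto_iff_norm_sub_tendsto_zero.1 ha

theorem eq_of_pairNorm_sub_sq_le {w a : X × Y}
    (h : pairNorm (w - a) ^ 2 ≤ pairNorm w ^ 2 - pairNorm a ^ 2) (hwa : pairNorm w ≤ pairNorm a) :
    w = a := by
  have h1 : pairNorm w ^ 2 ≤ pairNorm a ^ 2 := pow_le_pow_left₀ (norm_nonneg _) hwa 2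
  have h2 : pairNorm (w - a) = 0 := by
    have := sq_nonneg (pairNorm (w - a))
    exact (pow_eq_zero_iff two_ne_zero).1 (by linarith)
  exact sub_eq_zero.1 (WithLp.toLp_injective 2 (norm_eq_zero.1 h2))

theorem existsUnique_isMinNormElement (hf : ContDiff ℝ 1 f) (hconv : ConvexOn ℝ univ f)
    (hΩ : (primalDualSolutions f A b).Nonempty) :
    ∃! z : X × Y, IsMinNormElement (primalDualSolutions f A b) z := by
  -- The set Ω does not depend on the regularization, so any weight will do; here it is 1/t on [1,
  -- ∞), with the dummy value 0 before that.
  have hex : ∀ t : ℝ, ∃ z : X × Y, 1 ≤ t →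
      IsSaddlePointOn univ univ (regLagrangian f A b 1 1 t) z.1 z.2 := by
    intro t
    by_cases ht : 1 ≤ t
    · obtain ⟨z, hz⟩ := exists_isSaddlePointOn_tikhonovLagrangian (A := A) (b := b) hf hconv
        (show 0 < 1 / t ^ (1 : ℝ) from div_pos one_pos (Real.rpow_pos_of_pos (by linarith) _))
      exact ⟨z, fun _ => by rwa [regLagrangian_eq]⟩
    · exact ⟨0, fun h => absurd h ht⟩
  choose z hz using hex
  obtain ⟨a, -, ha, hav⟩ := exists_tendsto_saddle_path hf hconv hΩ one_pos one_pos one_pos hz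
  refine ⟨a, ⟨ha, fun w hw => ?_⟩, fun w hw => ?_⟩
  · refine le_of_sq_le_sq ?_ (norm_nonneg _)
    have := hav w hw
    have := sq_nonneg (pairNorm (w - a))
    linarith
  · exact eq_of_pairNorm_sub_sq_le (hav w hw.1) (hw.2 a ha)

theorem norm_fst_le_pairNorm (z : X × Y) : ‖z.1‖ ≤ pairNorm z := by
  refine le_of_sq_le_sq ?_ (norm_nonneg _)
  rw [pairNorm, WithLp.prod_norm_sq_eq_of_L2]
  exact le_add_of_nonneg_right (sq_nonneg _)

theorem norm_snd_le_pairNorm (z : X × Y) : ‖z.2‖ ≤ pairNorm z := by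
  refine le_of_sq_le_sq ?_ (norm_nonneg _)
  rw [pairNorm, WithLp.prod_norm_sq_eq_of_L2]
  exact le_add_of_nonneg_left (sq_nonneg _)

theorem pairNorm_le_add (z : X × Y) : pairNorm z ≤ ‖z.1‖ + ‖z.2‖ := by
  refine le_of_sq_le_sq ?_ (by positivity)
  rw [pairNorm, WithLp.prod_norm_sq_eq_of_L2]
  have := mul_nonneg (norm_nonneg z.1) (norm_nonneg z.2)
  change ‖z.1‖ ^ 2 + ‖z.2‖ ^ 2 ≤ _
  nlinarith

/-- The regularized saddle points are bounded and move with speed `O(1 / t)`. -/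
theorem exists_saddle_path_bound (hf : ContDiff ℝ 1 f) (hconv : ConvexOn ℝ univ f)
    (hΩ : (primalDualSolutions f A b).Nonempty) (hp : 0 < p) (hp₁ : p ≤ 1) (hc : 0 < c)
    (ht₀ : 0 < t₀) {z : ℝ → X × Y}
    (hz : ∀ t ≥ t₀, IsSaddlePointOn univ univ (regLagrangian f A b c p t) (z t).1 (z t).2) :
    ∃ R, 0 ≤ R ∧ (∀ t ≥ t₀, pairNorm (z t) ≤ R) ∧
      ∀ t ≥ t₀, ∀ r ≥ t, pairNorm (z r - z t) ≤ (r - t) * (R / t) := by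
  have hfd : Differentiable ℝ f := hf.differentiable one_ne_zero
  obtain ⟨w, hw⟩ := hΩ
  have hM := inner_saddleOperator_sub_nonneg (A := A) (b := b) hfd hconv
  have hpos : ∀ t ≥ t₀, 0 < c / t ^ p := fun t ht =>
    div_pos hc (Real.rpow_pos_of_pos (ht₀.trans_le ht) p)
  have hz' : ∀ t ≥ t₀, saddleOperator f A b (WithLp.toLp 2 (z t))
      + (c / t ^ p) • WithLp.toLp 2 (z t) = 0 := fun t ht => by
    have := hz t ht
    rwa [regLagrangian_eq, isSaddlePointOn_iff_saddleOperator hfd hconv (hpos t ht).le] at this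
  have hb : ∀ t ≥ t₀, pairNorm (z t) ≤ pairNorm w := by
    intro t ht
    have h := norm_sub_sq_le_of_regularized_zeros hM (hpos t ht) le_rfl
      (by simpa using (mem_primalDualSolutions_iff hfd hconv).1 hw) (hz' t ht)
    refine le_of_sq_le_sq ?_ (norm_nonneg _)
    have := sq_nonneg ‖WithLp.toLp 2 w - WithLp.toLp 2 (z t)‖
    simp only [pairNorm]
    linarith
  refine ⟨pairNorm w, norm_nonneg _, hb, fun t ht r hr => ?_⟩
  have ht0 : 0 < t := ht₀.trans_le ht
  have hr0 : 0 < r := ht0.trans_le hr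
  rcases hr.eq_or_lt with rfl | hlt
  · simp [pairNorm]
  have h := mul_norm_sub_le_of_regularized_zeros hM (tikhonov_weight_lt hp hc ht₀ t ht r hlt)
    (hz' r (ht.trans hr)) (hz' t ht)
  -- Factoring out the later weight lets it cancel; the remaining `(r / t) ^ p - 1` is at most `(r -
  -- t) / t` because `p ≤ 1`.
  have h1 : c / t ^ p - c / r ^ p = c / r ^ p * ((r / t) ^ p - 1) := by
    rw [Real.div_rpow hr0.le ht0.le]
    have := (Real.rpow_pos_of_pos hr0 p).ne'
    have := (Real.rpow_pos_of_pos ht0 p).ne'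
    field_simp
  rw [h1, mul_assoc] at h
  have h2 := le_of_mul_le_mul_left h (hpos r (ht.trans hr))
  have h3 : (r / t) ^ p ≤ r / t := by
    have : 1 ≤ r / t := (one_le_div ht0).2 hr
    simpa using Real.rpow_le_rpow_of_exponent_le this hp₁
  have h4 : r / t - 1 = (r - t) / t := by field_simp
  calc pairNorm (z r - z t) ≤ ((r / t) ^ p - 1) * pairNorm (z t) := h2
    _ ≤ ((r - t) / t) * pairNorm w := by
        refine mul_le_mul (by linarith) (hb t ht) (norm_nonneg _)
          (div_nonneg (by linarith) ht0.le)
    _ = _ := by ring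

end SaddlePoints

/-! ### Comparison with a power for Dini differential inequalities. -/

section DiniComparison

/-- Meant for an energy whose reference point moves in a merely Lipschitz way: `G` is the energy
with the reference frozen at time `t`, and `h` bounds the cost per unit time of moving it. -/
theorem frequently_slope_lt_of_le {E G h : ℝ → ℝ} {t G' ρ : ℝ} (hG : HasDerivAt G G' t)
    (hh : ContinuousAt h t) (heq : E t = G t) (hle : ∀ τ > t, E τ ≤ G τ + (τ - t) * h τ)
    (hρ : G' + h t < ρ) : ∃ᶠ τ in 𝓝[>] t, slope E t τ < ρ := by
  have h1 : Tendsto (slope G t) (𝓝[>] t) (𝓝 G') :=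
    (hasDerivAt_iff_tendsto_slope.1 hG).mono_left
      (nhdsWithin_mono t fun τ hτ => ne_of_gt hτ)
  have h2 : Tendsto h (𝓝[>] t) (𝓝 (h t)) := hh.tendsto.mono_left nhdsWithin_le_nhds
  have h3 := (h1.add h2).eventually (gt_mem_nhds hρ)
  refine (h3.and self_mem_nhdsWithin).frequently.mono ?_
  rintro τ ⟨hτ, hτt : t < τ⟩
  refine lt_of_le_of_lt ?_ hτ
  have hpos : 0 < τ - t := sub_pos.2 hτt
  rw [slope_def_field, slope_def_field, heq, div_add' _ _ _ hpos.ne',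
    div_le_div_iff_of_pos_right hpos]
  linarith [hle τ hτt]

/-- The function M t^(r-σ) is a barrier. At a contact point the right side of `hE'` equals (C - KM)
t^(-σ), whereas the slope of the barrier is M(r-σ) t^(r-σ-1), which is negligible against M t^(-σ)
since `r < 1`. -/
theorem exists_eventually_le_rpow_of_slope {E E' : ℝ → ℝ} {T K C r σ : ℝ} (hT : 0 < T)
    (hE : ContinuousOn E (Ici T))
    (hslope : ∀ t ≥ T, ∀ ρ, E' t < ρ → ∃ᶠ τ in 𝓝[>] t, slope E t τ < ρ)
    (hE' : ∀ t ≥ T, E' t ≤ -K * t ^ (-r) * E t + C * t ^ (-σ)) (hK : 0 < K) (hC : 0 ≤ C)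
    (hr : r < 1) : ∃ M, 0 ≤ M ∧ ∀ᶠ t in atTop, E t ≤ M * t ^ (r - σ) := by
  have hlim : Tendsto (fun t : ℝ => |r - σ| * t ^ (-(1 - r))) atTop (𝓝 (|r - σ| * 0)) :=
    (tendsto_rpow_neg_atTop (by linarith)).const_mul _
  rw [mul_zero] at hlim
  obtain ⟨T₁, hT₁⟩ := eventually_atTop.1
    ((hlim.eventually (gt_mem_nhds (show 0 < K / 2 by positivity))).and (eventually_ge_atTop T))
  have hT₁T : T ≤ T₁ := (hT₁ T₁ le_rfl).2
  have hT₁0 : 0 < T₁ := hT.trans_le hT₁T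
  -- The first entry starts the barrier above `E`; the second makes `C < M * (K / 2)`, so half of
  -- the damping beats the source and the other half pays for the slope of the barrier.
  set M := max (E T₁ / T₁ ^ (r - σ)) (2 * C / K + 1) with hM
  have hM1 : 2 * C / K + 1 ≤ M := le_max_right _ _
  have hMC : C < M * (K / 2) := by
    have : (2 * C / K + 1) * (K / 2) ≤ M * (K / 2) :=
      mul_le_mul_of_nonneg_right hM1 (by positivity)
    have h2 : (2 * C / K + 1) * (K / 2) = C + K / 2 := by field_simp
    linarith
  have hM0 : 0 < M := lt_of_lt_of_le (by positivity) hM1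
  refine ⟨M, hM0.le, ?_⟩
  filter_upwards [eventually_ge_atTop T₁] with S hS
  have hderiv : ∀ t ≥ T₁, HasDerivAt (fun t => M * t ^ (r - σ))
      (M * ((r - σ) * t ^ (r - σ - 1))) t := fun t ht =>
    (Real.hasDerivAt_rpow_const (Or.inl (hT₁0.trans_le ht).ne')).const_mul M
  refine image_le_of_liminf_slope_right_lt_deriv_boundary' (a := T₁) (b := S)
    (hE.mono fun t ht => hT₁T.trans ht.1) (fun t ht => hslope t (hT₁T.trans ht.1)) ?_
    (fun t ht => (hderiv t ht.1).continuousAt.continuousWithinAt)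
    (fun t ht => (hderiv t ht.1).hasDerivWithinAt) ?_ ⟨hS, le_rfl⟩
  · rw [← div_le_iff₀ (Real.rpow_pos_of_pos hT₁0 _)]
    exact le_max_left _ _
  · intro t ht hEt
    have ht0 : 0 < t := hT₁0.trans_le ht.1
    have h1 := hE' t (hT₁T.trans ht.1)
    have h2 := (hT₁ t ht.1).1
    have h3 : t ^ (r - σ) = t ^ r * t ^ (-σ) := by rw [← Real.rpow_add ht0]; ring_nf
    have h4 : t ^ (r - σ - 1) = t ^ (-(1 - r)) * t ^ (-σ) := by
      rw [← Real.rpow_add ht0]; ring_nf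
    have h5 : t ^ (-r) * t ^ r = 1 := by rw [← Real.rpow_add ht0]; simp
    have h6 : 0 < t ^ (-σ) := Real.rpow_pos_of_pos ht0 _
    rw [hEt, h3] at h1
    have h7 : -K * t ^ (-r) * (M * (t ^ r * t ^ (-σ))) = -K * M * t ^ (-σ) := by
      linear_combination (-K * M * t ^ (-σ)) * h5
    rw [h7] at h1
    rw [h4]
    have h8 : -(K / 2) ≤ (r - σ) * t ^ (-(1 - r)) := by
      have h9 := neg_abs_le (r - σ)
      have h10 : 0 < t ^ (-(1 - r)) := Real.rpow_pos_of_pos ht0 _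
      nlinarith
    have h11 : -(K / 2) * (M * t ^ (-σ)) ≤ (r - σ) * t ^ (-(1 - r)) * (M * t ^ (-σ)) :=
      mul_le_mul_of_nonneg_right h8 (by positivity)
    have h12 := mul_lt_mul_of_pos_right hMC h6
    linarith

end DiniComparison

/-! ### The Lyapunov energy: dissipation, and displacement of the reference point. -/

section Energy

open ContinuousLinearMap (adjoint)

variable {X Y : Type*}
  [NormedAddCommGroup X] [InnerProductSpace ℝ X] [CompleteSpace X]
  [NormedAddCommGroup Y] [InnerProductSpace ℝ Y] [CompleteSpace Y]

/-- The gap `L_t(x, m) - L_t(y, m)` of the regularized Lagrangian with Tikhonov weight `e`. -/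
noncomputable def lagrangianGap (f : X → ℝ) (A : X →L[ℝ] Y) (e : ℝ) (x y : X) (m : Y) : ℝ :=
  f x - f y + inner ℝ m (A (x - y)) + e / 2 * (‖x‖ ^ 2 - ‖y‖ ^ 2)

/-- The Lyapunov energy of a state `(x, v, l)` at time `t` with respect to the reference point
`(y, m)`; here `e` is the Tikhonov weight and `T` the time scaling. -/
noncomputable def lyapunovEnergy (f : X → ℝ) (A : X →L[ℝ] Y) (θ κ e T : ℝ)
    (x v : X) (l : Y) (y : X) (m : Y) : ℝ :=
  T * lagrangianGap f A e x y m + 1 / 2 * ‖θ⁻¹ • (x - y) + v‖ ^ 2 + κ / 2 * ‖x - y‖ ^ 2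
    + θ⁻¹ / 2 * ‖l - m‖ ^ 2

variable {f : X → ℝ} {A : X →L[ℝ] Y} {b : Y}

theorem lagrangianGap_eq (e : ℝ) (x y : X) (m : Y) :
    lagrangianGap f A e x y m
      = tikhonovLagrangian f A b e x m - tikhonovLagrangian f A b e y m := by
  have : (inner ℝ m (A (x - y)) : ℝ) = inner ℝ m (A x - b) - inner ℝ m (A y - b) := by
    rw [← inner_sub_right, map_sub]; congr 1; abel
  simp only [lagrangianGap, tikhonovLagrangian, lagrangian, this]
  ring

theorem lagrangianGap_add_le (hf : Differentiable ℝ f) (hconv : ConvexOn ℝ univ f)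
    (e : ℝ) (x y : X) (m : Y) :
    lagrangianGap f A e x y m + e / 2 * ‖x - y‖ ^ 2
      ≤ inner ℝ (gradient f x + adjoint A m + e • x) (x - y) := by
  have h := tikhonovLagrangian_ge (A := A) (b := 0) hf hconv e x y m
  rw [lagrangianGap_eq (b := 0)]
  rw [← neg_sub x y, inner_neg_right, norm_neg] at h
  linarith

theorem le_lagrangianGap (hf : Differentiable ℝ f) (hconv : ConvexOn ℝ univ f)
    (e : ℝ) (x y : X) (m : Y) :
    inner ℝ (gradient f y + adjoint A m + e • y) (x - y) + e / 2 * ‖x - y‖ ^ 2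
      ≤ lagrangianGap f A e x y m := by
  have h := tikhonovLagrangian_ge (A := A) (b := 0) hf hconv e y x m
  rw [lagrangianGap_eq (b := 0)]
  linarith

theorem hasDerivAt_lyapunovEnergy (hf : Differentiable ℝ f) {θ κ c p s t : ℝ} (ht : 0 < t)
    {x v : ℝ → X} {l : ℝ → Y} {x' v' : X} {l' : Y} (hx : HasDerivAt x x' t)
    (hv : HasDerivAt v v' t) (hl : HasDerivAt l l' t) (y : X) (m : Y) :
    HasDerivAt (fun τ => lyapunovEnergy f A θ κ (c / τ ^ p) (τ ^ s) (x τ) (v τ) (l τ) y m)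
      (s * t ^ (s - 1) * lagrangianGap f A (c / t ^ p) (x t) y m
        + t ^ s * (inner ℝ (gradient f (x t) + adjoint A m + (c / t ^ p) • x t) x'
          - p * (c / t ^ p) / t / 2 * (‖x t‖ ^ 2 - ‖y‖ ^ 2))
        + inner ℝ (θ⁻¹ • (x t - y) + v t) (θ⁻¹ • x' + v') + κ * inner ℝ (x t - y) x'
        + θ⁻¹ * inner ℝ (l t - m) l') t := by
  have hT : HasDerivAt (fun τ : ℝ => τ ^ s) (s * t ^ (s - 1)) t :=
    Real.hasDerivAt_rpow_const (Or.inl ht.ne')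
  have he : HasDerivAt (fun τ : ℝ => c / τ ^ p) (-(p * (c / t ^ p) / t)) t := by
    have h1 := ((Real.hasDerivAt_rpow_const (x := t) (p := p) (Or.inl ht.ne')).inv
      (Real.rpow_pos_of_pos ht p).ne').const_mul c
    refine (h1.congr_deriv ?_)
    rw [Real.rpow_sub_one ht.ne']
    have := (Real.rpow_pos_of_pos ht p).ne'
    field_simp
  have hfx : HasDerivAt (fun τ => f (x τ)) (inner ℝ (gradient f (x t)) x') t := by
    rw [inner_gradient_left]
    exact (hf (x t)).hasFDerivAt.comp_hasDerivAt t hx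
  have hAx : HasDerivAt (fun τ => (inner ℝ m (A (x τ - y)) : ℝ)) (inner ℝ (adjoint A m) x') t := by
    rw [ContinuousLinearMap.adjoint_inner_left]
    exact ((innerSL ℝ m).comp A).hasFDerivAt.comp_hasDerivAt t (hx.sub_const y)
  have hgap : HasDerivAt (fun τ => lagrangianGap f A (c / τ ^ p) (x τ) y m)
      (inner ℝ (gradient f (x t) + adjoint A m + (c / t ^ p) • x t) x'
          - p * (c / t ^ p) / t / 2 * (‖x t‖ ^ 2 - ‖y‖ ^ 2)) t := by
    have h1 := ((hfx.sub_const (f y)).add hAx).add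
      ((he.div_const 2).mul (hx.norm_sq.sub_const (‖y‖ ^ 2)))
    refine h1.congr_deriv ?_
    simp only [inner_add_left, inner_smul_left, conj_trivial]
    ring
  have h2 := (((hT.mul hgap).add
    ((((hx.sub_const y).const_smul θ⁻¹).add hv).norm_sq.const_mul (1 / 2))).add
    ((hx.sub_const y).norm_sq.const_mul (κ / 2))).add
    ((hl.sub_const m).norm_sq.const_mul (θ⁻¹ / 2))
  refine h2.congr_deriv ?_
  simp only [Pi.add_apply, Pi.smul_apply]
  ring

/-- Decrease of the energy along the flow, for a reference point that is a saddle point. -/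
theorem lyapunovEnergy_deriv_le (hf : Differentiable ℝ f) (hconv : ConvexOn ℝ univ f)
    {α θ e T : ℝ} (hθ : 0 < θ) (hT : 0 ≤ T) {x v y : X} {l m : Y}
    (hm : A y - b - e • m = 0) :
    T * inner ℝ (gradient f x + adjoint A m + e • x) v
        + inner ℝ (θ⁻¹ • (x - y) + v)
          (θ⁻¹ • v + (-(α • v) - T • (gradient f x + adjoint A l + e • x)))
        + (α - θ⁻¹) * θ⁻¹ * inner ℝ (x - y) v
        + θ⁻¹ * inner ℝ (l - m) (T • (A (x + θ • v) - b - e • l))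
      ≤ -(T * θ⁻¹) * lagrangianGap f A e x y m - T * e * θ⁻¹ / 2 * ‖x - y‖ ^ 2
        - (α - θ⁻¹) * ‖v‖ ^ 2 - T * e * θ⁻¹ * ‖l - m‖ ^ 2 := by
  set q := gradient f x + adjoint A m + e • x with hq
  have e1 : gradient f x + adjoint A l + e • x = q + adjoint A (l - m) := by
    rw [hq, map_sub]; abel
  have e2 : A (x + θ • v) - b - e • l = A (x - y) + θ • A v - e • (l - m) := by
    have : b = A y - e • m := by
      have := sub_eq_zero.1 hm
      rw [← this]; abel
    rw [this, map_add, map_smul, map_sub, smul_sub]; abel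
  have h := lagrangianGap_add_le (A := A) hf hconv e x y m
  rw [← hq] at h
  have h1 := mul_le_mul_of_nonneg_left h (mul_nonneg hT (inv_pos.2 hθ).le)
  have hθ' : θ⁻¹ * θ = 1 := inv_mul_cancel₀ hθ.ne'
  rw [e1, e2]
  generalize x - y = u at *
  generalize l - m = w at *
  simp only [inner_add_left, inner_add_right, inner_sub_right, inner_neg_right, inner_smul_left,
    inner_smul_right, conj_trivial, real_inner_self_eq_norm_sq, smul_add, smul_sub,
    ContinuousLinearMap.adjoint_inner_right, map_add, map_smul]
  rw [real_inner_comm v u, real_inner_comm w (A u), real_inner_comm w (A v), real_inner_comm v q]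
  rw [real_inner_comm u q] at h1
  generalize (inner ℝ v u : ℝ) = i1 at *
  generalize (inner ℝ w (A u) : ℝ) = i2 at *
  generalize (inner ℝ w (A v) : ℝ) = i3 at *
  generalize (inner ℝ u q : ℝ) = i4 at *
  generalize (inner ℝ v q : ℝ) = i5 at *
  -- The extrapolation term of the dual equation cancels the coupling ⟨Aᵀ(l - m), v⟩ from the primal
  -- one. The ⟨x - y, v⟩ terms cancel through the coefficient (α - θ⁻¹)θ⁻¹, and ⟨x - y, q⟩ is
  -- bounded below by convexity.
  have h2 : θ⁻¹ * (T * (θ * i3)) = T * i3 := by linear_combination (T * i3) * hθ'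
  linarith

theorem half_norm_sub_sq_le {E : Type*} [NormedAddCommGroup E] [InnerProductSpace ℝ E]
    (u d : E) {δ : ℝ} (hd : ‖d‖ ≤ δ) :
    1 / 2 * ‖u - d‖ ^ 2 ≤ 1 / 2 * ‖u‖ ^ 2 + δ * (‖u‖ + δ / 2) := by
  have h1 : ‖u - d‖ ≤ ‖u‖ + δ := (norm_sub_le u d).trans (by linarith)
  have h2 := pow_le_pow_left₀ (norm_nonneg _) h1 2
  nlinarith

/-- Effect on the energy of a displacement of the reference saddle point. -/
theorem lyapunovEnergy_move_le (hf : Differentiable ℝ f) (hconv : ConvexOn ℝ univ f)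
    {θ κ e e' T δ : ℝ} (hθ : 0 < θ) (hκ : 0 ≤ κ) (he' : 0 ≤ e') (hT : 0 ≤ T)
    {x v y y' : X} {l m m' : Y} (hy : gradient f y + adjoint A m + e • y = 0)
    (hy' : ‖y' - y‖ ≤ δ) (hm' : ‖m' - m‖ ≤ δ) :
    lyapunovEnergy f A θ κ e' T x v l y' m' ≤ lyapunovEnergy f A θ κ e' T x v l y m
      + δ * (T * (‖A‖ * ‖x - y‖ + (‖A‖ * δ + |e' - e| * ‖y‖))
        + θ⁻¹ * (‖θ⁻¹ • (x - y) + v‖ + θ⁻¹ * δ / 2) + κ * (‖x - y‖ + δ / 2)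
        + θ⁻¹ * (‖l - m‖ + δ / 2)) := by
  have hδ : 0 ≤ δ := (norm_nonneg _).trans hy'
  have hA := norm_nonneg A
  have hgap : lagrangianGap f A e' x y' m' ≤ lagrangianGap f A e' x y m
      + δ * (‖A‖ * ‖x - y‖ + (‖A‖ * δ + |e' - e| * ‖y‖)) := by
    have h1 := le_lagrangianGap (A := A) hf hconv e' y' y m'
    -- Stationarity of `y` for the old data leaves only the increments of the multiplier and of the
    -- weight, so apart from ⟨m' - m, A(x - y)⟩ the change of the gap is of second order in the
    -- displacement.
    have e1 : gradient f y + adjoint A m' + e' • y = adjoint A (m' - m) + (e' - e) • y := by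
      have : gradient f y = -(adjoint A m + e • y) := by
        rw [← add_eq_zero_iff_eq_neg, ← add_assoc]; exact hy
      rw [this, map_sub, sub_smul]; abel
    rw [e1] at h1
    have e2 : lagrangianGap f A e' x y' m' = lagrangianGap f A e' x y m
        + inner ℝ (m' - m) (A (x - y)) - lagrangianGap f A e' y' y m' := by
      have : A (x - y) = A (x - y') + A (y' - y) := by rw [← map_add]; congr 1; abel
      simp only [lagrangianGap, inner_sub_left]
      rw [this]
      simp only [inner_add_right]
      ring
    rw [e2]
    have h2 : inner ℝ (m' - m) (A (x - y)) ≤ δ * (‖A‖ * ‖x - y‖) :=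
      (real_inner_le_norm _ _).trans (mul_le_mul hm' (A.le_opNorm _) (norm_nonneg _) hδ)
    have h3 : -(δ * (‖A‖ * δ)) ≤ inner ℝ (adjoint A (m' - m)) (y' - y) := by
      rw [ContinuousLinearMap.adjoint_inner_left]
      refine (neg_le_neg ?_).trans (neg_abs_le _)
      refine (abs_real_inner_le_norm _ _).trans (mul_le_mul hm' ?_ (norm_nonneg _) hδ)
      exact (A.le_opNorm _).trans (mul_le_mul_of_nonneg_left hy' hA)
    have h4 : -(δ * (|e' - e| * ‖y‖)) ≤ inner ℝ ((e' - e) • y) (y' - y) := by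
      refine (neg_le_neg ?_).trans (neg_abs_le _)
      refine (abs_real_inner_le_norm _ _).trans ?_
      rw [norm_smul, Real.norm_eq_abs, mul_comm]
      exact mul_le_mul_of_nonneg_right hy' (by positivity)
    have h5 : 0 ≤ e' / 2 * ‖y' - y‖ ^ 2 := by positivity
    rw [inner_add_left] at h1
    linarith
  have hθ' : 0 < θ⁻¹ := inv_pos.2 hθ
  have h1 := mul_le_mul_of_nonneg_left hgap hT
  have h2 := half_norm_sub_sq_le (θ⁻¹ • (x - y) + v) (θ⁻¹ • (y' - y)) (δ := θ⁻¹ * δ) (by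
    rw [norm_smul, Real.norm_of_nonneg hθ'.le]
    exact mul_le_mul_of_nonneg_left hy' hθ'.le)
  have h3 := mul_le_mul_of_nonneg_left (half_norm_sub_sq_le (x - y) (y' - y) hy') hκ
  have h4 := mul_le_mul_of_nonneg_left (half_norm_sub_sq_le (l - m) (m' - m) hm') hθ'.le
  have e1 : θ⁻¹ • (x - y) + v - θ⁻¹ • (y' - y) = θ⁻¹ • (x - y') + v := by module
  have e2 : x - y - (y' - y) = x - y' := by abel
  have e3 : l - m - (m' - m) = l - m' := by abel
  rw [e1] at h2
  rw [e2] at h3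
  rw [e3] at h4
  simp only [lyapunovEnergy]
  linarith

end Energy

/-! ### The differential inequality for the energy along a trajectory. -/

section EnergyDecay

theorem mul_le_mul_sq_add_div (q X a : ℝ) (hq : 0 < q) : X * a ≤ q * a ^ 2 + X ^ 2 / (4 * q) := by
  have h : q * a ^ 2 + X ^ 2 / (4 * q) - X * a = (2 * q * a - X) ^ 2 / (4 * q) := by
    field_simp; ring
  have : 0 ≤ (2 * q * a - X) ^ 2 / (4 * q) := by positivity
  linarith

/-- The scalar core, used with U = t^s, V = t^p, Q = t^(-r), S = t^(-σ), where `D` is the gap and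
`a`, `b`, `d` are the norms of x - x_t, x', λ - λ_t. The gap and velocity are damped at a constant
rate (hence Q ≤ 1), the distances only at rate U/V (hence Q ≤ U/V). The conditions on `S` bound the
drift of the weight and the Young remainders. -/
theorem energy_rate_le {s t U V Q S D a b d η β κ c p R N K : ℝ} (ht : 0 < t)
    (hU : 0 < U) (hV : 0 < V) (hη : 0 < η) (hβ : 0 < β) (hc : 0 < c)
    (hp : 0 < p) (hD : 0 ≤ D) (hK : 0 ≤ K) (hK1 : K ≤ η / 2)
    (hK2 : K * (η ^ 2 + κ / 2) ≤ c * η / 4) (hK3 : K ≤ β / 2) (hK4 : K ≤ c)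
    (hQ1 : Q ≤ 1) (hQ2 : Q ≤ U / V) (hQ0 : 0 ≤ Q)
    (hS1 : U / (V * t) ≤ S) (hS2 : U * V / t ^ 2 ≤ S) (hS3 : V / (U * t ^ 2) ≤ S)
    (hS4 : 1 / t ^ 2 ≤ S) (hs : s * (U / t) ≤ U * η / 2) :
    s * (U / t) * D - U * η * D - U * (c / V) * η / 2 * a ^ 2 - β * b ^ 2
        - U * (c / V) * η * d ^ 2 + U * (p * (c / V) / t / 2 * R ^ 2)
        + R / t * (U * (N * a) + η * (η * a + b) + κ * a + η * d)
      ≤ -K * Q * (U * D + (η ^ 2 + κ / 2) * a ^ 2 + b ^ 2 + η / 2 * d ^ 2)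
        + (p * c * R ^ 2 / 2 + 2 * (R * N) ^ 2 / (c * η) + 2 * (R * (η ^ 2 + κ)) ^ 2 / (c * η)
          + (R * η) ^ 2 / (2 * β) + R ^ 2 * η / (2 * c)) * S := by
  have hm : 0 < U * (c / V) := by positivity
  -- Young's inequality spends half of each dissipative quadratic term; for `a ^ 2` that half is
  -- split between two drift terms. The other half gives the decay.
  have y1 := mul_le_mul_sq_add_div (U * (c / V) * η / 8) (R / t * (U * N)) a (by positivity)
  have y2 := mul_le_mul_sq_add_div (U * (c / V) * η / 8) (R / t * (η ^ 2 + κ)) a (by positivity)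
  have y3 := mul_le_mul_sq_add_div (β / 2) (R / t * η) b (by positivity)
  have y4 := mul_le_mul_sq_add_div (U * (c / V) * η / 2) (R / t * η) d (by positivity)
  have z0 : U * (p * (c / V) / t / 2 * R ^ 2) ≤ p * c * R ^ 2 / 2 * S := by
    have := mul_le_mul_of_nonneg_left hS1 (show 0 ≤ p * c * R ^ 2 / 2 by positivity)
    refine le_trans (le_of_eq ?_) this
    field_simp
  have z1 : (R / t * (U * N)) ^ 2 / (4 * (U * (c / V) * η / 8))
      ≤ 2 * (R * N) ^ 2 / (c * η) * S := by
    have := mul_le_mul_of_nonneg_left hS2 (show 0 ≤ 2 * (R * N) ^ 2 / (c * η) by positivity)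
    refine le_trans (le_of_eq ?_) this
    field_simp; ring
  have z2 : (R / t * (η ^ 2 + κ)) ^ 2 / (4 * (U * (c / V) * η / 8))
      ≤ 2 * (R * (η ^ 2 + κ)) ^ 2 / (c * η) * S := by
    have := mul_le_mul_of_nonneg_left hS3
      (show 0 ≤ 2 * (R * (η ^ 2 + κ)) ^ 2 / (c * η) by positivity)
    refine le_trans (le_of_eq ?_) this
    field_simp; ring
  have z3 : (R / t * η) ^ 2 / (4 * (β / 2)) ≤ (R * η) ^ 2 / (2 * β) * S := by
    have := mul_le_mul_of_nonneg_left hS4 (show 0 ≤ (R * η) ^ 2 / (2 * β) by positivity)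
    refine le_trans (le_of_eq ?_) this
    field_simp; ring
  have z4 : (R / t * η) ^ 2 / (4 * (U * (c / V) * η / 2)) ≤ R ^ 2 * η / (2 * c) * S := by
    have := mul_le_mul_of_nonneg_left hS3 (show 0 ≤ R ^ 2 * η / (2 * c) by positivity)
    refine le_trans (le_of_eq ?_) this
    field_simp; ring
  have k1 : K * Q * (U * D) ≤ η / 2 * (U * D) :=
    mul_le_mul_of_nonneg_right ((mul_le_of_le_one_right hK hQ1).trans hK1) (by positivity)
  have k2 : K * Q * ((η ^ 2 + κ / 2) * a ^ 2) ≤ U * (c / V) * η / 4 * a ^ 2 := by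
    have h1 : K * (η ^ 2 + κ / 2) * Q ≤ c * η / 4 * (U / V) :=
      mul_le_mul hK2 hQ2 hQ0 (by positivity)
    have h2 := mul_le_mul_of_nonneg_right h1 (sq_nonneg a)
    have h3 : c * η / 4 * (U / V) = U * (c / V) * η / 4 := by ring
    rw [h3] at h2
    linarith
  have k3 : K * Q * b ^ 2 ≤ β / 2 * b ^ 2 :=
    mul_le_mul_of_nonneg_right ((mul_le_of_le_one_right hK hQ1).trans hK3) (by positivity)
  have k4 : K * Q * (η / 2 * d ^ 2) ≤ U * (c / V) * η / 2 * d ^ 2 := by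
    have h1 : K * Q ≤ c * (U / V) := mul_le_mul hK4 hQ2 hQ0 hc.le
    have h2 := mul_le_mul_of_nonneg_right h1 (show 0 ≤ η / 2 * d ^ 2 by positivity)
    have h3 : c * (U / V) = U * (c / V) := by ring
    rw [h3] at h2
    linarith
  have k5 := mul_le_mul_of_nonneg_right hs hD
  simp only [add_mul _ _ S]
  linarith only [y1, y2, y3, y4, z0, z1, z2, z3, z4, k1, k2, k3, k4, k5]

open ContinuousLinearMap (adjoint)

variable {X Y : Type*}
  [NormedAddCommGroup X] [InnerProductSpace ℝ X] [CompleteSpace X]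
  [NormedAddCommGroup Y] [InnerProductSpace ℝ Y] [CompleteSpace Y]
  {f : X → ℝ} {A : X →L[ℝ] Y} {b : Y} {α θ p c s t₀ : ℝ} {x : ℝ → X} {l : ℝ → Y}

theorem hasDerivAt_velocity {E : Type*} [NormedAddCommGroup E] [NormedSpace ℝ E] {x : ℝ → E}
    (h : DifferentiableOn ℝ x (Ici t₀)) {t : ℝ} (ht : t₀ < t) :
    HasDerivAt x (derivWithin x (Ici t₀) t) t :=
  ((h t ht.le).hasDerivWithinAt).hasDerivAt (Ici_mem_nhds ht)

theorem IsTrajectory.hasDerivAt_x (h : IsTrajectory f A b α θ 0 p c s t₀ x l) {t : ℝ}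
    (ht : t₀ < t) : HasDerivAt x (velocity t₀ x t) t :=
  hasDerivAt_velocity h.differentiable_x ht

theorem IsTrajectory.hasDerivAt_velocity (h : IsTrajectory f A b α θ 0 p c s t₀ x l)
    (hf : Differentiable ℝ f) {t : ℝ} (ht : t₀ < t) :
    HasDerivAt (velocity t₀ x) (-(α • velocity t₀ x t)
      - t ^ s • (gradient f (x t) + adjoint A (l t) + (c / t ^ p) • x t)) t := by
  refine (_root_.hasDerivAt_velocity h.differentiable_velocity ht).congr_deriv ?_
  have h1 := h.primal_eq t ht.le
  rw [gradient_lagrangian_left hf, Real.rpow_zero, div_one, add_assoc] at h1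
  rw [← neg_add']
  exact eq_neg_of_add_eq_zero_left h1

theorem IsTrajectory.hasDerivAt_l (h : IsTrajectory f A b α θ 0 p c s t₀ x l) {t : ℝ}
    (ht : t₀ < t) :
    HasDerivAt l (t ^ s • (A (x t + θ • velocity t₀ x t) - b - (c / t ^ p) • l t)) t := by
  refine (_root_.hasDerivAt_velocity h.differentiable_l ht).congr_deriv ?_
  have h1 := h.dual_eq t ht.le
  rw [gradient_lagrangian_right, Real.rpow_zero, mul_one, zero_add] at h1
  exact sub_eq_zero.1 h1

theorem continuousOn_lyapunovEnergy (hf : Continuous f) {κ : ℝ} {S : Set ℝ}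
    {x v y : ℝ → X} {l m : ℝ → Y}
    (hx : ContinuousOn x S) (hv : ContinuousOn v S) (hl : ContinuousOn l S)
    (hy : ContinuousOn y S) (hm : ContinuousOn m S) (hpos : ∀ t ∈ S, 0 < t) :
    ContinuousOn (fun t => lyapunovEnergy f A θ κ (c / t ^ p) (t ^ s) (x t) (v t) (l t)
      (y t) (m t)) S := by
  have h1 : ContinuousOn (fun t : ℝ => t ^ s) S := fun t ht =>
    (Real.continuousAt_rpow_const t s (Or.inl (hpos t ht).ne')).continuousWithinAt
  have h2 : ContinuousOn (fun t : ℝ => t ^ p) S := fun t ht =>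
    (Real.continuousAt_rpow_const t p (Or.inl (hpos t ht).ne')).continuousWithinAt
  have h3 : ContinuousOn (fun t : ℝ => c / t ^ p) S :=
    continuousOn_const.div h2 fun t ht => (Real.rpow_pos_of_pos (hpos t ht) p).ne'
  have hfx := hf.comp_continuousOn hx
  have hfy := hf.comp_continuousOn hy
  simp only [Function.comp_def] at hfx hfy
  unfold lyapunovEnergy lagrangianGap
  fun_prop

theorem continuousOn_of_norm_sub_le {E : Type*} [NormedAddCommGroup E] {z : ℝ → E} {R : ℝ}
    (ht₀ : 0 < t₀) (h : ∀ t ≥ t₀, ∀ r ≥ t, ‖z r - z t‖ ≤ (r - t) * (R / t)) (hR : 0 ≤ R) :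
    ContinuousOn z (Ici t₀) := by
  have hle : ∀ t ≥ t₀, ∀ r ≥ t, ‖z r - z t‖ ≤ R / t₀ * |r - t| := fun t ht r hr => by
    refine (h t ht r hr).trans ?_
    rw [mul_comm, abs_of_nonneg (by linarith)]
    gcongr
  have : LipschitzOnWith (Real.toNNReal (R / t₀)) z (Ici t₀) := by
    refine LipschitzOnWith.of_dist_le_mul fun r hr t ht => ?_
    rw [Real.coe_toNNReal _ (by positivity), dist_eq_norm, Real.dist_eq]
    rcases le_total t r with htr | htr
    · exact hle t ht r htr
    · rw [norm_sub_rev, abs_sub_comm]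
      exact hle r hr t htr
  exact this.continuousOn

theorem lagrangianGap_nonneg (hf : Differentiable ℝ f) (hconv : ConvexOn ℝ univ f) {e : ℝ}
    (he : 0 ≤ e) {x y : X} {m : Y} (hy : gradient f y + adjoint A m + e • y = 0) :
    0 ≤ lagrangianGap f A e x y m := by
  have h := le_lagrangianGap (A := A) hf hconv e x y m
  rw [hy, inner_zero_left] at h
  have : 0 ≤ e / 2 * ‖x - y‖ ^ 2 := by positivity
  linarith

/-- Bounds the energy by the quantities that are dissipated, so that dissipation becomes a negative
multiple of the energy itself. -/
theorem lyapunovEnergy_le {κ e T : ℝ} (x v y : X) (l m : Y) :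
    lyapunovEnergy f A θ κ e T x v l y m ≤ T * lagrangianGap f A e x y m
      + (θ⁻¹ ^ 2 + κ / 2) * ‖x - y‖ ^ 2 + ‖v‖ ^ 2 + θ⁻¹ / 2 * ‖l - m‖ ^ 2 := by
  have h1 := norm_add_sq_real (θ⁻¹ • (x - y)) v
  have h2 := norm_sub_sq_real (θ⁻¹ • (x - y)) v
  have h3 := sq_nonneg ‖θ⁻¹ • (x - y) - v‖
  have h4 : ‖θ⁻¹ • (x - y)‖ ^ 2 = θ⁻¹ ^ 2 * ‖x - y‖ ^ 2 := by
    rw [norm_smul, mul_pow, Real.norm_eq_abs, sq_abs]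
  rw [h4] at h1 h2
  simp only [lyapunovEnergy]
  linarith

/-- Decay of the Lyapunov energy relative to the path of regularized saddle points. -/
theorem IsTrajectory.exists_energy_le (hsol : IsTrajectory f A b α θ 0 p c s t₀ x l)
    (hf : ContDiff ℝ 1 f) (hconv : ConvexOn ℝ univ f) (hα : 0 < α) (hθ : 1 / α < θ)
    (hp₀ : 0 < p) (hc : 0 < c) (ht₀ : 0 < t₀) {y : ℝ → X} {m : ℝ → Y}
    {R : ℝ} (hR : 0 ≤ R)
    (hstat : ∀ t ≥ t₀, gradient f (y t) + adjoint A (m t) + (c / t ^ p) • y t = 0 ∧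
      A (y t) - b - (c / t ^ p) • m t = 0)
    (hyR : ∀ t ≥ t₀, ‖y t‖ ≤ R)
    (hyL : ∀ t ≥ t₀, ∀ r ≥ t, ‖y r - y t‖ ≤ (r - t) * (R / t))
    (hmL : ∀ t ≥ t₀, ∀ r ≥ t, ‖m r - m t‖ ≤ (r - t) * (R / t))
    {r σ : ℝ} (hr0 : 0 ≤ r) (hr1 : r < 1) (hrp : p - s ≤ r) (hσ1 : σ ≤ p + 1 - s)
    (hσ2 : σ ≤ 2 - p - s) (hσ3 : σ ≤ 2 + s - p) :
    ∃ M, 0 ≤ M ∧ ∀ᶠ t in atTop, lyapunovEnergy f A θ ((α - θ⁻¹) * θ⁻¹) (c / t ^ p) (t ^ s) (x t)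
      (velocity t₀ x t) (l t) (y t) (m t) ≤ M * t ^ (r - σ) := by
  have hfd : Differentiable ℝ f := hf.differentiable one_ne_zero
  have hθ0 : 0 < θ := lt_trans (by positivity) hθ
  set η := θ⁻¹ with hη
  have hη0 : 0 < η := inv_pos.2 hθ0
  have hβ : 0 < α - η := by
    rw [sub_pos, hη, inv_lt_comm₀ hθ0 hα, ← one_div]; exact hθ
  set β := α - η with hβdef
  set κ := β * η with hκ
  have hκ0 : 0 < κ := mul_pos hβ hη0
  obtain ⟨K, hK0, hK1, hK2, hK3, hK4⟩ : ∃ K, 0 < K ∧ K ≤ η / 2 ∧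
      K * (η ^ 2 + κ / 2) ≤ c * η / 4 ∧ K ≤ β / 2 ∧ K ≤ c := by
    have hden : 0 < η ^ 2 + κ / 2 := by positivity
    refine ⟨min (min (η / 2) (c * η / 4 / (η ^ 2 + κ / 2))) (min (β / 2) c), ?_,
      (min_le_left _ _).trans (min_le_left _ _), ?_,
      (min_le_right _ _).trans (min_le_left _ _), (min_le_right _ _).trans (min_le_right _ _)⟩
    · refine lt_min (lt_min ?_ ?_) (lt_min ?_ hc) <;> positivity
    · rw [← le_div_iff₀ hden]
      exact (min_le_left _ _).trans (min_le_right _ _)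
  -- Beyond `t₀` one-sided derivatives are two-sided; beyond 1 powers are ordered by exponent;
  -- beyond `2 * |s| / η` the derivative of the factor t^s costs at most half of the dissipation of
  -- the gap.
  set T := max (t₀ + 1) (max 1 (2 * |s| / η)) with hT
  have hTt₀ : ∀ t ≥ T, t₀ < t := fun t ht => by
    have := (le_max_left _ _).trans ht; linarith
  have hT1 : ∀ t ≥ T, 1 ≤ t := fun t ht => ((le_max_left _ _).trans (le_max_right _ _)).trans ht
  have hTs : ∀ t ≥ T, 2 * |s| / η ≤ t := fun t ht =>
    ((le_max_right _ _).trans (le_max_right _ _)).trans ht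
  have hT0 : 0 < T := one_pos.trans_le (hT1 T le_rfl)
  refine exists_eventually_le_rpow_of_slope (T := T) (K := K) (r := r) (σ := σ)
    (C := p * c * R ^ 2 / 2 + 2 * (R * ‖A‖) ^ 2 / (c * η) + 2 * (R * (η ^ 2 + κ)) ^ 2 / (c * η)
          + (R * η) ^ 2 / (2 * β) + R ^ 2 * η / (2 * c))
    (E' := fun t => s * t ^ (s - 1) * lagrangianGap f A (c / t ^ p) (x t) (y t) (m t)
        + t ^ s * (inner ℝ (gradient f (x t) + adjoint A (m t) + (c / t ^ p) • x t)
            (velocity t₀ x t)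
          - p * (c / t ^ p) / t / 2 * (‖x t‖ ^ 2 - ‖y t‖ ^ 2))
        + inner ℝ (η • (x t - y t) + velocity t₀ x t) (η • velocity t₀ x t +
          (-(α • velocity t₀ x t)
            - t ^ s • (gradient f (x t) + adjoint A (l t) + (c / t ^ p) • x t)))
        + κ * inner ℝ (x t - y t) (velocity t₀ x t)
        + η * inner ℝ (l t - m t)
          (t ^ s • (A (x t + θ • velocity t₀ x t) - b - (c / t ^ p) • l t))
        + R / t * (t ^ s * (‖A‖ * ‖x t - y t‖) + η * ‖η • (x t - y t) + velocity t₀ x t‖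
          + κ * ‖x t - y t‖ + η * ‖l t - m t‖)) hT0 ?_ ?_ ?_ hK0 (by positivity) hr1
  · have hsub : Ici T ⊆ Ici t₀ := fun t ht => (hTt₀ t ht).le
    exact continuousOn_lyapunovEnergy hf.continuous
      (hsol.differentiable_x.continuousOn.mono hsub)
      (hsol.differentiable_velocity.continuousOn.mono hsub)
      (hsol.differentiable_l.continuousOn.mono hsub)
      ((continuousOn_of_norm_sub_le ht₀ hyL hR).mono hsub)
      ((continuousOn_of_norm_sub_le ht₀ hmL hR).mono hsub) (fun t ht => hT0.trans_le ht)
  · intro t ht ρ hρ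
    have ht0 : t₀ < t := hTt₀ t ht
    have hx := hsol.hasDerivAt_x ht0
    have hv := hsol.hasDerivAt_velocity hfd ht0
    have hl := hsol.hasDerivAt_l ht0
    have htpos : 0 < t := ht₀.trans ht0
    -- The displacement over [t, τ] is at most (τ - t)R/t. The second-order corrections kept in `h`
    -- vanish at τ = t, which leaves the drift term of `E'`.
    refine frequently_slope_lt_of_le
      (hasDerivAt_lyapunovEnergy (A := A) (θ := θ) (κ := κ) (c := c) (p := p) (s := s) hfd htpos
        hx hv hl (y t) (m t))
      (h := fun τ => R / t * (τ ^ s * (‖A‖ * ‖x τ - y t‖ + (‖A‖ * ((τ - t) * (R / t))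
          + |c / τ ^ p - c / t ^ p| * ‖y t‖))
        + η * (‖η • (x τ - y t) + velocity t₀ x τ‖ + η * ((τ - t) * (R / t)) / 2)
        + κ * (‖x τ - y t‖ + ((τ - t) * (R / t)) / 2)
        + η * (‖l τ - m t‖ + ((τ - t) * (R / t)) / 2))) ?_ rfl ?_ ?_
    · have h1 := hx.continuousAt
      have h2 := hv.continuousAt
      have h3 := hl.continuousAt
      have h4 : ContinuousAt (fun τ : ℝ => τ ^ s) t :=
        Real.continuousAt_rpow_const t s (Or.inl htpos.ne')
      have h5 : ContinuousAt (fun τ : ℝ => c / τ ^ p) t :=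
        continuousAt_const.div (Real.continuousAt_rpow_const t p (Or.inl htpos.ne'))
          (Real.rpow_pos_of_pos htpos p).ne'
      fun_prop
    · intro τ hτ
      have hτ0 : 0 < τ := htpos.trans hτ
      have h1 := lyapunovEnergy_move_le (A := A) (κ := κ) (e := c / t ^ p) (e' := c / τ ^ p)
        (T := τ ^ s) (x := x τ) (v := velocity t₀ x τ) (l := l τ) hfd hconv hθ0 hκ0.le
        (by positivity) (by positivity) (hstat t ht0.le).1 (hyL t ht0.le τ hτ.le)
        (hmL t ht0.le τ hτ.le)
      rw [← hη] at h1
      refine h1.trans (le_of_eq ?_)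
      ring
    · refine lt_of_le_of_lt (le_of_eq ?_) hρ
      simp only [sub_self, zero_mul, mul_zero, zero_div, add_zero, abs_zero]
      rw [← hη]
  · intro t ht
    have ht0 : t₀ < t := hTt₀ t ht
    have htpos : 0 < t := ht₀.trans ht0
    have h1t := hT1 t ht
    have hU : 0 < t ^ s := Real.rpow_pos_of_pos htpos s
    have hV : 0 < t ^ p := Real.rpow_pos_of_pos htpos p
    have hD := lagrangianGap_nonneg (A := A) (x := x t) hfd hconv
      (show 0 ≤ c / t ^ p by positivity) (hstat t ht0.le).1
    have hdec := lyapunovEnergy_deriv_le (A := A) (α := α) (T := t ^ s) (x := x t)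
      (v := velocity t₀ x t) (l := l t) hfd hconv hθ0 hU.le (hstat t ht0.le).2
    have hup := lyapunovEnergy_le (f := f) (A := A) (θ := θ) (κ := κ) (e := c / t ^ p)
      (T := t ^ s) (x t) (velocity t₀ x t) (y t) (l t) (m t)
    rw [← hη] at hdec hup
    have hQ0 : 0 < t ^ (-r) := Real.rpow_pos_of_pos htpos _
    have hrate := energy_rate_le (s := s) (t := t) (U := t ^ s) (V := t ^ p) (Q := t ^ (-r))
      (S := t ^ (-σ)) (D := lagrangianGap f A (c / t ^ p) (x t) (y t) (m t))
      (a := ‖x t - y t‖) (b := ‖velocity t₀ x t‖) (d := ‖l t - m t‖) (R := R) (N := ‖A‖)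
      htpos hU hV hη0 hβ hc hp₀ hD hK0.le hK1 hK2 hK3 hK4
      (Real.rpow_le_one_of_one_le_of_nonpos h1t (by linarith))
      (by
        rw [← Real.rpow_sub htpos]
        exact Real.rpow_le_rpow_of_exponent_le h1t (by linarith))
      hQ0.le
      (by
        rw [← Real.rpow_add_one htpos.ne', ← Real.rpow_sub htpos]
        exact Real.rpow_le_rpow_of_exponent_le h1t (by linarith))
      (by
        rw [← Real.rpow_add htpos, ← Real.rpow_natCast, ← Real.rpow_sub htpos]
        exact Real.rpow_le_rpow_of_exponent_le h1t (by push_cast; linarith))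
      (by
        rw [← Real.rpow_natCast, ← Real.rpow_add htpos, ← Real.rpow_sub htpos]
        exact Real.rpow_le_rpow_of_exponent_le h1t (by push_cast; linarith))
      (by
        rw [← Real.rpow_natCast, one_div, ← Real.rpow_neg htpos.le]
        exact Real.rpow_le_rpow_of_exponent_le h1t (by push_cast; linarith))
      (by
        have h1 := hTs t ht
        rw [div_le_iff₀ hη0] at h1
        have h2 : s ≤ t * η / 2 := (le_abs_self s).trans (by linarith)
        have h3 := mul_le_mul_of_nonneg_right h2 (div_pos hU htpos).le
        refine h3.trans (le_of_eq ?_)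
        field_simp)
    have hKQ : -K * t ^ (-r) * (t ^ s * lagrangianGap f A (c / t ^ p) (x t) (y t) (m t)
        + (η ^ 2 + κ / 2) * ‖x t - y t‖ ^ 2 + ‖velocity t₀ x t‖ ^ 2 + η / 2 * ‖l t - m t‖ ^ 2)
        ≤ -K * t ^ (-r) * lyapunovEnergy f A θ κ (c / t ^ p) (t ^ s) (x t) (velocity t₀ x t)
          (l t) (y t) (m t) :=
      mul_le_mul_of_nonpos_left hup (by rw [neg_mul]; exact neg_nonpos.2 (mul_pos hK0 hQ0).le)
    have hyterm : t ^ s * (p * (c / t ^ p) / t / 2 * ‖y t‖ ^ 2)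
        ≤ t ^ s * (p * (c / t ^ p) / t / 2 * R ^ 2) := by
      have := pow_le_pow_left₀ (norm_nonneg _) (hyR t ht0.le) 2
      gcongr
    have hxterm : 0 ≤ t ^ s * (p * (c / t ^ p) / t / 2 * ‖x t‖ ^ 2) := by positivity
    have hnorm : ‖η • (x t - y t) + velocity t₀ x t‖ ≤ η * ‖x t - y t‖ + ‖velocity t₀ x t‖ := by
      refine (norm_add_le _ _).trans (le_of_eq ?_)
      rw [norm_smul, Real.norm_of_nonneg hη0.le]
    have hdrift : R / t * (t ^ s * (‖A‖ * ‖x t - y t‖)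
          + η * ‖η • (x t - y t) + velocity t₀ x t‖ + κ * ‖x t - y t‖ + η * ‖l t - m t‖)
        ≤ R / t * (t ^ s * (‖A‖ * ‖x t - y t‖)
          + η * (η * ‖x t - y t‖ + ‖velocity t₀ x t‖) + κ * ‖x t - y t‖ + η * ‖l t - m t‖) := by
      gcongr
    refine le_trans ?_ (hrate.trans (add_le_add_left hKQ _))
    rw [Real.rpow_sub_one htpos.ne']
    linarith

end EnergyDecay

/-! ### Asymptotic comparison of powers. -/

section PowerRates

theorem eventually_one_div_rpow_nonneg (k : ℝ) : ∀ᶠ t : ℝ in atTop, 0 ≤ 1 / t ^ k :=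
  (eventually_ge_atTop 0).mono fun t ht => by positivity

theorem isBigO_one_div_rpow_of_le {g : ℝ → ℝ} {C k k' : ℝ}
    (hg : ∀ᶠ t in atTop, |g t| ≤ C * t ^ k') (hk : k' ≤ -k) :
    g =O[atTop] fun t => 1 / t ^ k := by
  refine IsBigO.of_bound |C| ?_
  filter_upwards [hg, eventually_ge_atTop 1] with t ht h1
  have h0 : (0 : ℝ) < t := one_pos.trans_le h1
  rw [one_div, ← Real.rpow_neg h0.le, Real.norm_eq_abs, Real.norm_of_nonneg (by positivity)]
  exact ht.trans (mul_le_mul (le_abs_self C) (Real.rpow_le_rpow_of_exponent_le h1 hk)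
    (by positivity) (abs_nonneg C))

theorem isBigO_one_div_rpow {k k' : ℝ} (hk : k ≤ k') :
    (fun t : ℝ => 1 / t ^ k') =O[atTop] fun t => 1 / t ^ k := by
  refine isBigO_one_div_rpow_of_le (C := 1) (k' := -k') ?_ (by linarith)
  filter_upwards [eventually_ge_atTop 1] with t h1
  have h0 : (0 : ℝ) < t := one_pos.trans_le h1
  rw [one_mul, one_div, ← Real.rpow_neg h0.le, abs_of_nonneg (by positivity)]

theorem isBigO_left_add {φ ψ : ℝ → ℝ} (hφ : ∀ᶠ t in atTop, 0 ≤ φ t)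
    (hψ : ∀ᶠ t in atTop, 0 ≤ ψ t) : φ =O[atTop] fun t => φ t + ψ t := by
  refine IsBigO.of_bound' ?_
  filter_upwards [hφ, hψ] with t h1 h2
  rw [Real.norm_of_nonneg h1, Real.norm_of_nonneg (by positivity)]
  linarith

theorem isBigO_right_add {φ ψ : ℝ → ℝ} (hφ : ∀ᶠ t in atTop, 0 ≤ φ t)
    (hψ : ∀ᶠ t in atTop, 0 ≤ ψ t) : ψ =O[atTop] fun t => φ t + ψ t := by
  simpa only [add_comm] using isBigO_left_add hψ hφ

theorem isBigO_one_div_rpow_add (k j : ℝ) :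
    ((fun t : ℝ => 1 / t ^ k) =O[atTop] fun t => 1 / t ^ k + 1 / t ^ j) ∧
      ((fun t : ℝ => 1 / t ^ j) =O[atTop] fun t => 1 / t ^ k + 1 / t ^ j) :=
  ⟨isBigO_left_add (eventually_one_div_rpow_nonneg k) (eventually_one_div_rpow_nonneg j),
    isBigO_right_add (eventually_one_div_rpow_nonneg k) (eventually_one_div_rpow_nonneg j)⟩

theorem isBigO_one_div_rpow_half_of_sq {g : ℝ → ℝ} {k : ℝ}
    (h : (fun t => g t ^ 2) =O[atTop] fun t => 1 / t ^ k) :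
    g =O[atTop] fun t => 1 / t ^ (k / 2) := by
  refine IsBigO.of_pow two_ne_zero (h.congr' (EventuallyEq.refl _ _) ?_)
  filter_upwards [eventually_gt_atTop 0] with t ht
  rw [Pi.pow_apply, one_div_pow, ← Real.rpow_mul_natCast ht.le]
  congr 2
  push_cast; ring

theorem tendsto_one_div_rpow_zero {k : ℝ} (hk : 0 < k) :
    Tendsto (fun t : ℝ => 1 / t ^ k) atTop (𝓝 0) :=
  (tendsto_rpow_atTop hk).const_div_atTop 1

end PowerRates

/-! ### From energy decay to rates for the gap, the residual and the objective. -/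

section Rates

open ContinuousLinearMap (adjoint)

variable {X Y : Type*}
  [NormedAddCommGroup X] [InnerProductSpace ℝ X] [CompleteSpace X]
  [NormedAddCommGroup Y] [InnerProductSpace ℝ Y] [CompleteSpace Y]
  {f : X → ℝ} {A : X →L[ℝ] Y} {b : Y} {α θ p c s t₀ : ℝ} {x : ℝ → X} {l : ℝ → Y}

/-- The constant is independent of `e` and `T`, hence uniform in time. The velocity is recovered
from θ⁻¹(x - y) + v by subtracting the already controlled θ⁻¹(x - y). -/
theorem exists_norm_sq_le_lyapunovEnergy (f : X → ℝ) (A : X →L[ℝ] Y) {κ : ℝ} (hθ : 0 < θ)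
    (hκ : 0 < κ) : ∃ C, ∀ {e T : ℝ} (x v y : X) (l m : Y), 0 ≤ T * lagrangianGap f A e x y m →
      T * lagrangianGap f A e x y m ≤ lyapunovEnergy f A θ κ e T x v l y m ∧
      ‖x - y‖ ^ 2 ≤ C * lyapunovEnergy f A θ κ e T x v l y m ∧
      ‖l - m‖ ^ 2 ≤ C * lyapunovEnergy f A θ κ e T x v l y m ∧
      ‖v‖ ^ 2 ≤ C * lyapunovEnergy f A θ κ e T x v l y m := by
  refine ⟨max (2 * κ⁻¹) (max (2 * θ) (4 + 4 * θ⁻¹ ^ 2 * κ⁻¹)), fun {e T} x v y l m hgap => ?_⟩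
  set E := lyapunovEnergy f A θ κ e T x v l y m with hE
  have hθ' : 0 < θ⁻¹ := inv_pos.2 hθ
  have hP : 0 ≤ 1 / 2 * ‖θ⁻¹ • (x - y) + v‖ ^ 2 := by positivity
  have hu : 0 ≤ κ / 2 * ‖x - y‖ ^ 2 := by positivity
  have hw : 0 ≤ θ⁻¹ / 2 * ‖l - m‖ ^ 2 := by positivity
  have hE' : E = T * lagrangianGap f A e x y m + 1 / 2 * ‖θ⁻¹ • (x - y) + v‖ ^ 2
      + κ / 2 * ‖x - y‖ ^ 2 + θ⁻¹ / 2 * ‖l - m‖ ^ 2 := rfl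
  have hE0 : 0 ≤ E := by linarith
  have hu' : ‖x - y‖ ^ 2 ≤ 2 * κ⁻¹ * E := by
    have h1 : κ / 2 * ‖x - y‖ ^ 2 ≤ E := by linarith
    have h2 := mul_le_mul_of_nonneg_left h1 (show 0 ≤ 2 * κ⁻¹ by positivity)
    have h3 : 2 * κ⁻¹ * (κ / 2 * ‖x - y‖ ^ 2) = ‖x - y‖ ^ 2 := by field_simp
    linarith
  refine ⟨by linarith, ?_, ?_, ?_⟩
  · exact hu'.trans (mul_le_mul_of_nonneg_right (le_max_left _ _) hE0)
  · refine le_trans ?_ (mul_le_mul_of_nonneg_right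
      ((le_max_left _ _).trans (le_max_right _ _)) hE0)
    have h1 : θ⁻¹ / 2 * ‖l - m‖ ^ 2 ≤ E := by linarith
    have h2 := mul_le_mul_of_nonneg_left h1 (show 0 ≤ 2 * θ by positivity)
    have h3 : 2 * θ * (θ⁻¹ / 2 * ‖l - m‖ ^ 2) = ‖l - m‖ ^ 2 := by field_simp
    linarith
  · refine le_trans ?_ (mul_le_mul_of_nonneg_right
      ((le_max_right _ _).trans (le_max_right _ _)) hE0)
    have h1 : ‖v‖ ^ 2 ≤ 2 * ‖θ⁻¹ • (x - y) + v‖ ^ 2 + 2 * (θ⁻¹ ^ 2 * ‖x - y‖ ^ 2) := by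
      have h2 : ‖v‖ ≤ ‖θ⁻¹ • (x - y) + v‖ + θ⁻¹ * ‖x - y‖ := by
        have h3 := norm_sub_le (θ⁻¹ • (x - y) + v) (θ⁻¹ • (x - y))
        rwa [add_sub_cancel_left, norm_smul θ⁻¹, Real.norm_of_nonneg hθ'.le] at h3
      have h3 := pow_le_pow_left₀ (norm_nonneg _) h2 2
      nlinarith [sq_nonneg (‖θ⁻¹ • (x - y) + v‖ - θ⁻¹ * ‖x - y‖)]
    have h2 := mul_le_mul_of_nonneg_left hu' (show 0 ≤ 2 * θ⁻¹ ^ 2 by positivity)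
    linarith

/-- The Lagrangian gap at a primal-dual solution is controlled by the regularized gap, the
feasibility violation and the Tikhonov weight. -/
theorem lagrangian_sub_le (hf : Differentiable ℝ f) (hconv : ConvexOn ℝ univ f) {e : ℝ}
    (he : 0 ≤ e) {xs : X} {ls : Y} (hfeas : A xs = b) {x y : X} {m : Y}
    (hy : gradient f y + adjoint A m + e • y = 0) :
    lagrangian f A b x ls - lagrangian f A b xs ls
      ≤ lagrangianGap f A e x y m + ‖ls - m‖ * ‖A x - b‖ + e / 2 * ‖xs‖ ^ 2 := by
  -- Minimality of `y` for the multiplier `m` allows replacing `y` by the feasible `xs`, at the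
  -- price of its Tikhonov term.
  have h1 := lagrangianGap_nonneg (A := A) (x := xs) hf hconv he hy
  have h2 := real_inner_le_norm (ls - m) (A x - b)
  have h3 : 0 ≤ e / 2 * ‖x‖ ^ 2 := by positivity
  rw [lagrangianGap_eq (b := b)] at h1 ⊢
  simp only [tikhonovLagrangian, lagrangian, hfeas, sub_self, inner_zero_right, inner_sub_left]
    at h1 h2 ⊢
  linarith

theorem isBigO_lagrangian_sub (hf : Differentiable ℝ f) (hconv : ConvexOn ℝ univ f)
    (hc : 0 < c) (ht₀ : 0 < t₀) {y : ℝ → X} {m : ℝ → Y} {R : ℝ}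
    (hstat : ∀ t ≥ t₀, gradient f (y t) + adjoint A (m t) + (c / t ^ p) • y t = 0)
    (hmR : ∀ t ≥ t₀, ‖m t‖ ≤ R) {xs : X} {ls : Y} (hs : (xs, ls) ∈ primalDualSolutions f A b)
    (hfeas : A xs = b) {φ : ℝ → ℝ}
    (hD : (fun t => lagrangianGap f A (c / t ^ p) (x t) (y t) (m t)) =O[atTop] φ)
    (hA : (fun t => ‖A (x t) - b‖) =O[atTop] φ) (hφ : (fun t => 1 / t ^ p) =O[atTop] φ) :
    ((fun t => lagrangian f A b (x t) ls - lagrangian f A b xs ls) =O[atTop] φ) ∧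
      (fun t => |f (x t) - f xs|) =O[atTop] φ := by
  have hL : (fun t => lagrangian f A b (x t) ls - lagrangian f A b xs ls) =O[atTop] φ := by
    have hsum := (hD.add (hA.const_mul_left (‖ls‖ + R))).add (hφ.const_mul_left (c / 2 * ‖xs‖ ^ 2))
    refine IsBigO.trans (IsBigO.of_bound' ?_) hsum
    filter_upwards [eventually_ge_atTop t₀] with t ht
    have htpos : 0 < t := ht₀.trans_le ht
    have h1 := lagrangian_sub_le (b := b) (x := x t) (ls := ls) hf hconv
      (show 0 ≤ c / t ^ p by positivity) hfeas (hstat t ht)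
    have h0 : lagrangian f A b xs ls ≤ lagrangian f A b (x t) ls :=
      hs (x t) (mem_univ _) ls (mem_univ _)
    have h2 : ‖ls - m t‖ * ‖A (x t) - b‖ ≤ (‖ls‖ + R) * ‖A (x t) - b‖ :=
      mul_le_mul_of_nonneg_right ((norm_sub_le _ _).trans (by linarith [hmR t ht]))
        (norm_nonneg _)
    rw [Real.norm_of_nonneg (by linarith)]
    refine le_trans ?_ (Real.le_norm_self _)
    have h3 : c / t ^ p / 2 * ‖xs‖ ^ 2 = c / 2 * ‖xs‖ ^ 2 * (1 / t ^ p) := by ring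
    linarith
  refine ⟨hL, ?_⟩
  have hsum := hL.norm_left.add (hA.const_mul_left ‖ls‖)
  refine IsBigO.trans (IsBigO.of_bound' (Eventually.of_forall fun t => ?_)) hsum
  have h1 := abs_real_inner_le_norm ls (A (x t) - b)
  have h2 : f (x t) - f xs
      = lagrangian f A b (x t) ls - lagrangian f A b xs ls - inner ℝ ls (A (x t) - b) := by
    simp only [lagrangian, hfeas, sub_self, inner_zero_right]
    ring
  have h3 := abs_sub (lagrangian f A b (x t) ls - lagrangian f A b xs ls)
    (inner ℝ ls (A (x t) - b))
  rw [Real.norm_eq_abs, abs_abs, h2]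
  refine le_trans ?_ (Real.le_norm_self _)
  rw [Real.norm_eq_abs]
  linarith

/-- Stationarity in the multiplier says that the regularized point itself has residual (c/t^p) m, so
A x - b = A(x - y) + (c/t^p) m. -/
theorem isBigO_residual (hc : 0 < c) (ht₀ : 0 < t₀) {y : ℝ → X} {m : ℝ → Y} {R k : ℝ}
    (hstat : ∀ t ≥ t₀, A (y t) - b - (c / t ^ p) • m t = 0) (hmR : ∀ t ≥ t₀, ‖m t‖ ≤ R)
    (hu : (fun t => ‖x t - y t‖) =O[atTop] fun t => 1 / t ^ k) :
    (fun t => ‖A (x t) - b‖) =O[atTop] fun t => 1 / t ^ p + 1 / t ^ k := by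
  obtain ⟨h1, h2⟩ := isBigO_one_div_rpow_add p k
  have hsum := ((hu.trans h2).const_mul_left ‖A‖).add (h1.const_mul_left (c * R))
  refine IsBigO.trans (IsBigO.of_bound' ?_) hsum
  filter_upwards [eventually_ge_atTop t₀] with t ht
  have htpos : 0 < t := ht₀.trans_le ht
  have e1 : A (x t) - b = A (x t - y t) + (c / t ^ p) • m t := by
    rw [← sub_eq_zero.1 (hstat t ht), map_sub]; abel
  rw [norm_norm, e1]
  refine le_trans (norm_add_le _ _) (le_trans ?_ (Real.le_norm_self _))
  refine add_le_add (A.le_opNorm _) ?_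
  rw [norm_smul, Real.norm_of_nonneg (by positivity)]
  have := mul_le_mul_of_nonneg_left (hmR t ht) (show 0 ≤ c / t ^ p by positivity)
  refine this.trans (le_of_eq ?_)
  ring

/-- For a bounded dual trajectory the feasibility violation decays like the slower one of
`t ^ (-s)` and the Tikhonov weight. -/
theorem IsTrajectory.isBigO_residual_of_bounded (hsol : IsTrajectory f A b α θ 0 p c s t₀ x l)
    (hθ : 0 < θ) (hc : 0 < c) (hs₀ : 0 < s) (hsp : s ≤ p) (ht₀ : 0 < t₀) {B : ℝ}
    (hB : ∀ᶠ t in atTop, ‖l t‖ ≤ B) :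
    (fun t => ‖A (x t) - b‖) =O[atTop] fun t => 1 / t ^ s := by
  obtain ⟨T₁, hT₁⟩ := eventually_atTop.1 hB
  set η := θ⁻¹ with hη
  have hη0 : 0 < η := inv_pos.2 hθ
  set T := max (t₀ + 1) (max 1 T₁) with hT
  have hTt₀ : ∀ t ≥ T, t₀ < t := fun t ht => by
    have := (le_max_left _ _).trans ht; linarith
  have hT1 : ∀ t ≥ T, 1 ≤ t := fun t ht => ((le_max_left _ _).trans (le_max_right _ _)).trans ht
  have hTB : ∀ t ≥ T, ‖l t‖ ≤ B := fun t ht =>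
    hT₁ t (((le_max_right _ _).trans (le_max_right _ _)).trans ht)
  have hT0 : 0 < T := one_pos.trans_le (hT1 T le_rfl)
  -- Subtracting θ⁻¹ t^(-s) λ from the residual cancels `A x'` in the derivative, by the dual
  -- equation. What remains is the damped equation h' = η(w - h), with `w` of order t^(-s).
  set h : ℝ → Y := fun t => A (x t) - b - (η * t ^ (-s)) • l t with hh
  set w : ℝ → Y := fun t => (c / t ^ p + s * t ^ (-s - 1) - η * t ^ (-s)) • l t with hw
  have hderiv : ∀ t ≥ T, HasDerivAt h (η • (w t - h t)) t := by
    intro t ht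
    have ht0 := hTt₀ t ht
    have htpos : 0 < t := ht₀.trans ht0
    have h1 := (A.hasFDerivAt.comp_hasDerivAt t (hsol.hasDerivAt_x ht0)).sub_const b
    have h2 := ((Real.hasDerivAt_rpow_const (x := t) (p := -s) (Or.inl htpos.ne')).const_mul
      η).smul (hsol.hasDerivAt_l ht0)
    refine (h1.sub h2).congr_deriv ?_
    have h3 : t ^ (-s) * t ^ s = 1 := by rw [← Real.rpow_add htpos]; simp
    have h4 : η * θ = 1 := inv_mul_cancel₀ hθ.ne'
    rw [smul_smul, mul_assoc η, h3, mul_one, map_add, map_smul]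
    simp only [hw, hh, smul_sub, smul_add, smul_smul, h4, one_smul, sub_smul, add_smul]
    module
  have hwb : ∀ t ≥ T, ‖w t‖ ≤ (c + s + η) * B * t ^ (-s) := by
    intro t ht
    have h1 := hT1 t ht
    have htpos : 0 < t := one_pos.trans_le h1
    have h2 : c / t ^ p ≤ c * t ^ (-s) := by
      rw [div_eq_mul_inv, ← Real.rpow_neg htpos.le]
      exact mul_le_mul_of_nonneg_left (Real.rpow_le_rpow_of_exponent_le h1 (by linarith)) hc.le
    have h3 : s * t ^ (-s - 1) ≤ s * t ^ (-s) :=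
      mul_le_mul_of_nonneg_left (Real.rpow_le_rpow_of_exponent_le h1 (by linarith)) hs₀.le
    have h4 : 0 < c / t ^ p := by positivity
    have h5 : 0 < s * t ^ (-s - 1) := by positivity
    have h6 : 0 < η * t ^ (-s) := by positivity
    have h7 : |c / t ^ p + s * t ^ (-s - 1) - η * t ^ (-s)| ≤ (c + s + η) * t ^ (-s) := by
      rw [abs_le]
      have : 0 < t ^ (-s) := by positivity
      have : 0 < c * t ^ (-s) := by positivity
      have : 0 < s * t ^ (-s) := by positivity
      constructor <;> linarith
    rw [hw]
    simp only [norm_smul, Real.norm_eq_abs]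
    refine (mul_le_mul h7 (hTB t ht) (norm_nonneg _) (by positivity)).trans (le_of_eq ?_)
    ring
  obtain ⟨M, hM0, hM⟩ := exists_eventually_le_rpow_of_slope (T := T) (K := η) (r := 0)
    (σ := 2 * s) (C := η / 2 * ((c + s + η) * B) ^ 2) (E := fun t => 1 / 2 * ‖h t‖ ^ 2)
    (E' := fun t => 1 / 2 * (2 * inner ℝ (h t) (η • (w t - h t)))) hT0 (by
      have : ContinuousOn h (Ici T) := fun t ht =>
        (hderiv t ht).continuousAt.continuousWithinAt
      fun_prop) (by
      intro t ht ρ hρ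
      refine frequently_slope_lt_of_le ((hderiv t ht).norm_sq.const_mul (1 / 2))
        (h := fun _ => 0) continuousAt_const rfl (fun τ _ => by simp) (by simpa using hρ)) (by
      intro t ht
      have htpos : 0 < t := one_pos.trans_le (hT1 t ht)
      have h1 := real_inner_le_norm (h t) (w t)
      have h2 := pow_le_pow_left₀ (norm_nonneg _) (hwb t ht) 2
      have h3 : (t ^ (-s)) ^ 2 = t ^ (-(2 * s)) := by
        rw [← Real.rpow_mul_natCast htpos.le]; congr 1; push_cast; ring
      rw [mul_pow _ (t ^ (-s)), h3] at h2
      have h4 := sq_nonneg (‖h t‖ - ‖w t‖)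
      simp only [inner_smul_right, inner_sub_right, real_inner_self_eq_norm_sq, neg_zero,
        Real.rpow_zero]
      have h5 : inner ℝ (h t) (w t) ≤ 1 / 2 * ‖h t‖ ^ 2
          + 1 / 2 * (((c + s + η) * B) ^ 2 * t ^ (-(2 * s))) := by linarith
      have h6 := mul_le_mul_of_nonneg_left h5 hη0.le
      linarith) hη0 (by positivity) one_pos
  have hhO : (fun t => ‖h t‖) =O[atTop] fun t => 1 / t ^ s := by
    have h1 : (fun t => ‖h t‖ ^ 2) =O[atTop] fun t => 1 / t ^ (2 * s) := by
      refine isBigO_one_div_rpow_of_le (C := 2 * M) (k' := 0 - 2 * s) ?_ (by linarith)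
      filter_upwards [hM] with t ht
      rw [abs_of_nonneg (by positivity)]
      linarith
    simpa using isBigO_one_div_rpow_half_of_sq h1
  have hsum := hhO.add ((isBigO_refl (fun t : ℝ => 1 / t ^ s) atTop).const_mul_left (η * B))
  refine IsBigO.trans (IsBigO.of_bound' ?_) hsum
  filter_upwards [eventually_ge_atTop T] with t ht
  have htpos : 0 < t := one_pos.trans_le (hT1 t ht)
  have e1 : A (x t) - b = h t + (η * t ^ (-s)) • l t := by simp only [hh]; abel
  rw [norm_norm, e1]
  refine le_trans (norm_add_le _ _) (le_trans ?_ (Real.le_norm_self _))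
  refine add_le_add le_rfl ?_
  rw [norm_smul, Real.norm_of_nonneg (by positivity), Real.rpow_neg htpos.le]
  have := mul_le_mul_of_nonneg_left (hTB t ht) (show 0 ≤ η * (t ^ s)⁻¹ by positivity)
  refine this.trans (le_of_eq ?_)
  ring

/-- The decay of the energy, expressed through its constituents. -/
theorem IsTrajectory.isBigO_of_energy (hsol : IsTrajectory f A b α θ 0 p c s t₀ x l)
    (hf : ContDiff ℝ 1 f) (hconv : ConvexOn ℝ univ f) (hα : 0 < α) (hθ : 1 / α < θ)
    (hp₀ : 0 < p) (hc : 0 < c) (ht₀ : 0 < t₀) {y : ℝ → X} {m : ℝ → Y}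
    {R : ℝ} (hR : 0 ≤ R)
    (hstat : ∀ t ≥ t₀, gradient f (y t) + adjoint A (m t) + (c / t ^ p) • y t = 0 ∧
      A (y t) - b - (c / t ^ p) • m t = 0)
    (hyR : ∀ t ≥ t₀, ‖y t‖ ≤ R)
    (hyL : ∀ t ≥ t₀, ∀ r ≥ t, ‖y r - y t‖ ≤ (r - t) * (R / t))
    (hmL : ∀ t ≥ t₀, ∀ r ≥ t, ‖m r - m t‖ ≤ (r - t) * (R / t))
    {r σ k : ℝ} (hr0 : 0 ≤ r) (hr1 : r < 1) (hrp : p - s ≤ r) (hσ1 : σ ≤ p + 1 - s)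
    (hσ2 : σ ≤ 2 - p - s) (hσ3 : σ ≤ 2 + s - p) (hk : k = σ - r) :
    ((fun t => lagrangianGap f A (c / t ^ p) (x t) (y t) (m t))
        =O[atTop] fun t => 1 / t ^ (k + s)) ∧
      ((fun t => ‖x t - y t‖ ^ 2) =O[atTop] fun t => 1 / t ^ k) ∧
      ((fun t => ‖l t - m t‖ ^ 2) =O[atTop] fun t => 1 / t ^ k) ∧
      ((fun t => ‖velocity t₀ x t‖ ^ 2) =O[atTop] fun t => 1 / t ^ k) := by
  have hθ0 : 0 < θ := lt_trans (by positivity) hθ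
  have hκ : 0 < (α - θ⁻¹) * θ⁻¹ := by
    refine mul_pos ?_ (inv_pos.2 hθ0)
    rw [sub_pos, inv_lt_comm₀ hθ0 hα, ← one_div]; exact hθ
  obtain ⟨M, hM0, hM⟩ := hsol.exists_energy_le hf hconv hα hθ hp₀ hc ht₀ hR hstat hyR hyL hmL
    hr0 hr1 hrp hσ1 hσ2 hσ3
  obtain ⟨C, hC⟩ := exists_norm_sq_le_lyapunovEnergy f A hθ0 hκ
  have hgap : ∀ t ≥ t₀, 0 ≤ lagrangianGap f A (c / t ^ p) (x t) (y t) (m t) := fun t ht => by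
    have htpos : 0 < t := ht₀.trans_le ht
    exact lagrangianGap_nonneg (hf.differentiable one_ne_zero) hconv (by positivity) (hstat t ht).1
  have key : ∀ g : ℝ → ℝ, (∀ t ≥ t₀, 0 ≤ g t ∧ g t ≤ C * lyapunovEnergy f A θ ((α - θ⁻¹) * θ⁻¹)
      (c / t ^ p) (t ^ s) (x t) (velocity t₀ x t) (l t) (y t) (m t)) →
      g =O[atTop] fun t => 1 / t ^ k := by
    intro g hg
    refine isBigO_one_div_rpow_of_le (C := |C| * M) (k' := r - σ) ?_ (by linarith)
    filter_upwards [hM, eventually_ge_atTop t₀] with t ht ht0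
    have htpos : 0 < t := ht₀.trans_le ht0
    have hE0 := (mul_nonneg (show 0 ≤ t ^ s by positivity) (hgap t ht0)).trans
      (hC (x t) (velocity t₀ x t) (y t) (l t) (m t)
        (mul_nonneg (show 0 ≤ t ^ s by positivity) (hgap t ht0))).1
    rw [abs_of_nonneg (hg t ht0).1, mul_assoc]
    exact (hg t ht0).2.trans ((mul_le_mul_of_nonneg_right (le_abs_self C) hE0).trans
      (mul_le_mul_of_nonneg_left ht (abs_nonneg C)))
  have hall : ∀ t ≥ t₀, _ := fun t ht =>
    hC (e := c / t ^ p) (T := t ^ s) (x t) (velocity t₀ x t) (y t) (l t) (m t)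
      (mul_nonneg (Real.rpow_nonneg (ht₀.trans_le ht).le s) (hgap t ht))
  refine ⟨?_, key _ fun t ht => ⟨by positivity, (hall t ht).2.1⟩,
    key _ fun t ht => ⟨by positivity, (hall t ht).2.2.1⟩,
    key _ fun t ht => ⟨by positivity, (hall t ht).2.2.2⟩⟩
  refine isBigO_one_div_rpow_of_le (C := M) (k' := r - σ - s) ?_ (by linarith)
  filter_upwards [hM, eventually_ge_atTop t₀] with t ht ht0
  have htpos : 0 < t := ht₀.trans_le ht0
  rw [abs_of_nonneg (hgap t ht0), Real.rpow_sub htpos _ s, ← mul_div_assoc,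
    le_div_iff₀ (Real.rpow_pos_of_pos htpos s), mul_comm]
  exact (hall t ht0).1.trans ht

end Rates

/-! ### Choice of the exponents and assembly. -/

theorem corollary3p1
    {X Y : Type*}
    [NormedAddCommGroup X] [InnerProductSpace ℝ X] [CompleteSpace X]
    [NormedAddCommGroup Y] [InnerProductSpace ℝ Y] [CompleteSpace Y]
    (f : X → ℝ) (hf : ContDiff ℝ 1 f) (hconv : ConvexOn ℝ univ f)
    (A : X →L[ℝ] Y) (b : Y) (hΩ : (primalDualSolutions f A b).Nonempty)
    (α θ p c s t₀ : ℝ) (hα : 0 < α) (hθ : 1 / α < θ) (hp₀ : 0 < p) (hp₁ : p < 1) (hc : 0 < c)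
    (hs₀ : p - 1 < s) (hs₁ : s < 1) (ht₀ : 0 < t₀)
    (x : ℝ → X) (l : ℝ → Y) (hsol : IsTrajectory f A b α θ 0 p c s t₀ x l) :
    -- the minimum norm solution and the saddle points of `L_t` exist and are unique
    (∃! z : X × Y, IsMinNormElement (primalDualSolutions f A b) z) ∧
    (∀ t ≥ t₀, ∃! w : X × Y, IsSaddlePointOn univ univ (regLagrangian f A b c p t) w.1 w.2) ∧
    ∀ (xs : X) (ls : Y), IsMinNormElement (primalDualSolutions f A b) (xs, ls) →
    ∀ (xt : ℝ → X) (lt : ℝ → Y),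
      (∀ t ≥ t₀, IsSaddlePointOn univ univ (regLagrangian f A b c p t) (xt t) (lt t)) →
      -- strong convergence
      Tendsto (fun t => pairNorm ((x t, l t) - (xs, ls))) atTop (𝓝 0) ∧
      -- (i)
      (s < (p - 1) / 2 →
        ((fun t => ‖x t - xt t‖ ^ 2) =O[atTop] fun t => 1 / t ^ (2 * (1 + s - p))) ∧
        ((fun t => ‖l t - lt t‖ ^ 2) =O[atTop] fun t => 1 / t ^ (2 * (1 + s - p))) ∧
        ((fun t => ‖velocity t₀ x t‖ ^ 2) =O[atTop] fun t => 1 / t ^ (2 * (1 + s - p))) ∧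
        ((fun t => ‖A (x t) - b‖) =O[atTop] fun t => 1 / t ^ p + 1 / t ^ (1 + s - p)) ∧
        ((2 * p - 2) / 3 < s →
          ((fun t => regLagrangian f A b c p t (x t) (lt t)
              - regLagrangian f A b c p t (xt t) (lt t))
            =O[atTop] fun t => 1 / t ^ (3 * s - 2 * p + 2)) ∧
          ((fun t => lagrangian f A b (x t) ls - lagrangian f A b xs ls)
            =O[atTop] fun t => 1 / t ^ p + 1 / t ^ (3 * s - 2 * p + 2)) ∧
          ((fun t => |f (x t) - f xs|)
            =O[atTop] fun t => 1 / t ^ p + 1 / t ^ (3 * s - 2 * p + 2)))) ∧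
      -- (ii), with `r = max 0 (p - s)`
      ((p - 1) / 2 ≤ s →
        ∀ r : ℝ, r = max 0 (p - s) →
        ((fun t => regLagrangian f A b c p t (x t) (lt t)
            - regLagrangian f A b c p t (xt t) (lt t))
          =O[atTop] fun t => 1 / t ^ (1 - r)) ∧
        ((fun t => ‖x t - xt t‖ ^ 2) =O[atTop] fun t => 1 / t ^ (1 - s - r)) ∧
        ((fun t => ‖l t - lt t‖ ^ 2) =O[atTop] fun t => 1 / t ^ (1 - s - r)) ∧
        ((fun t => ‖velocity t₀ x t‖ ^ 2) =O[atTop] fun t => 1 / t ^ (1 - s - r)) ∧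
        ((fun t => lagrangian f A b (x t) ls - lagrangian f A b xs ls)
          =O[atTop] fun t => 1 / t ^ p + 1 / t ^ ((1 - s - r) / 2)) ∧
        ((fun t => |f (x t) - f xs|)
          =O[atTop] fun t => 1 / t ^ p + 1 / t ^ ((1 - s - r) / 2)) ∧
        ((fun t => ‖A (x t) - b‖)
          =O[atTop] fun t => 1 / t ^ p + 1 / t ^ ((1 - s - r) / 2))) ∧
      -- (iii)
      (0 < s → s ≤ p →
        ((fun t => lagrangian f A b (x t) ls - lagrangian f A b xs ls)
          =O[atTop] fun t => 1 / t ^ s) ∧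
        ((fun t => |f (x t) - f xs|) =O[atTop] fun t => 1 / t ^ s) ∧
        ((fun t => ‖A (x t) - b‖) =O[atTop] fun t => 1 / t ^ s)) := by

  have hfd : Differentiable ℝ f := hf.differentiable one_ne_zero
  refine ⟨existsUnique_isMinNormElement hf hconv hΩ, fun t ht => ?_, ?_⟩
  · rw [regLagrangian_eq]
    exact existsUnique_isSaddlePointOn_tikhonovLagrangian hf hconv
      (div_pos hc (Real.rpow_pos_of_pos (ht₀.trans_le ht) p))
  intro xs ls hmin xt lt hsad
  have hθ0 : 0 < θ := lt_trans (by positivity) hθ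
  have hstat : ∀ t ≥ t₀, gradient f (xt t) + ContinuousLinearMap.adjoint A (lt t)
      + (c / t ^ p) • xt t = 0 ∧ A (xt t) - b - (c / t ^ p) • lt t = 0 := fun t ht => by
    have h := hsad t ht
    rwa [regLagrangian_eq, isSaddlePointOn_tikhonovLagrangian_iff hfd hconv
      (div_pos hc (Real.rpow_pos_of_pos (ht₀.trans_le ht) p)).le] at h
  have hfeas : A xs = b := by
    have h := hmin.1
    have h' : IsSaddlePointOn univ univ (tikhonovLagrangian f A b 0) xs ls := by
      rw [tikhonovLagrangian_zero]; exact h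
    have h2 := ((isSaddlePointOn_tikhonovLagrangian_iff hfd hconv le_rfl).1 h').2
    rwa [zero_smul, sub_zero, sub_eq_zero] at h2
  obtain ⟨R, hR, hzR, hzL⟩ := exists_saddle_path_bound hf hconv hΩ hp₀ hp₁.le hc ht₀
    (z := fun t => (xt t, lt t)) hsad
  have hyR : ∀ t ≥ t₀, ‖xt t‖ ≤ R := fun t ht => (norm_fst_le_pairNorm _).trans (hzR t ht)
  have hmR : ∀ t ≥ t₀, ‖lt t‖ ≤ R := fun t ht => (norm_snd_le_pairNorm _).trans (hzR t ht)
  have hyL : ∀ t ≥ t₀, ∀ r ≥ t, ‖xt r - xt t‖ ≤ (r - t) * (R / t) := fun t ht r hr =>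
    (norm_fst_le_pairNorm ((xt r, lt r) - (xt t, lt t))).trans (hzL t ht r hr)
  have hmL : ∀ t ≥ t₀, ∀ r ≥ t, ‖lt r - lt t‖ ≤ (r - t) * (R / t) := fun t ht r hr =>
    (norm_snd_le_pairNorm ((xt r, lt r) - (xt t, lt t))).trans (hzL t ht r hr)
  have hgap : ∀ t, regLagrangian f A b c p t (x t) (lt t) - regLagrangian f A b c p t (xt t) (lt t)
      = lagrangianGap f A (c / t ^ p) (x t) (xt t) (lt t) := fun t => by
    rw [regLagrangian_eq, lagrangianGap_eq (b := b)]
  simp only [hgap]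
  have rates := fun {r σ k : ℝ} => hsol.isBigO_of_energy (r := r) (σ := σ) (k := k) hf hconv hα hθ
    hp₀ hc ht₀ hR hstat hyR hyL hmL
  have lag := fun {φ : ℝ → ℝ} => isBigO_lagrangian_sub (x := x) (φ := φ) hfd hconv hc ht₀
    (fun t ht => (hstat t ht).1) hmR hmin.1 hfeas
  have res := fun {k : ℝ} => isBigO_residual (x := x) (k := k) hc ht₀
    (fun t ht => (hstat t ht).2) hmR
  -- the rates below and above the threshold
  have low : s < (p - 1) / 2 → _ := fun hs => rates (r := p - s) (σ := 2 + s - p)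
    (k := 2 * (1 + s - p)) (by linarith) (by linarith) le_rfl (by linarith) (by linarith) le_rfl
    (by ring)
  -- The choice σ = 1 - s meets σ ≤ 2 + s - p exactly when (p - 1)/2 ≤ s; the other two bounds on σ
  -- only need 0 ≤ p ≤ 1.
  have high : (p - 1) / 2 ≤ s → _ := fun hs => rates (r := max 0 (p - s)) (σ := 1 - s)
    (k := 1 - s - max 0 (p - s)) (le_max_left _ _) (max_lt one_pos (by linarith))
    (le_max_right _ _) (by linarith) (by linarith) (by linarith) rfl
  have dist_zero : Tendsto (fun t => ‖x t - xt t‖) atTop (𝓝 0) ∧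
      Tendsto (fun t => ‖l t - lt t‖) atTop (𝓝 0) := by
    rcases lt_or_ge s ((p - 1) / 2) with hs | hs
    · obtain ⟨-, h1, h2, -⟩ := low hs
      have hk := tendsto_one_div_rpow_zero (k := 2 * (1 + s - p) / 2) (by linarith)
      exact ⟨(isBigO_one_div_rpow_half_of_sq h1).trans_tendsto hk,
        (isBigO_one_div_rpow_half_of_sq h2).trans_tendsto hk⟩
    · obtain ⟨-, h1, h2, -⟩ := high hs
      have hk := tendsto_one_div_rpow_zero (k := (1 - s - max 0 (p - s)) / 2) (by
        have : max 0 (p - s) < 1 - s := max_lt (by linarith) (by linarith)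
        linarith)
      exact ⟨(isBigO_one_div_rpow_half_of_sq h1).trans_tendsto hk,
        (isBigO_one_div_rpow_half_of_sq h2).trans_tendsto hk⟩
  refine ⟨?_, fun hs => ?_, fun hs r hr => ?_, fun hs hsp => ?_⟩
  · obtain ⟨a, ha, hamem, hav⟩ := exists_tendsto_saddle_path hf hconv hΩ hp₀ hc ht₀
      (z := fun t => (xt t, lt t)) hsad
    have hxa : (xs, ls) = a := eq_of_pairNorm_sub_sq_le (hav _ hmin.1) (hmin.2 a hamem)
    rw [← hxa] at ha
    have hsum := (dist_zero.1.add dist_zero.2).add ha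
    rw [add_zero, add_zero] at hsum
    refine squeeze_zero (fun t => norm_nonneg _) (fun t => ?_) hsum
    have h1 : pairNorm ((x t, l t) - (xs, ls))
        ≤ pairNorm ((x t, l t) - (xt t, lt t)) + pairNorm ((xt t, lt t) - (xs, ls)) := by
      have : (x t, l t) - (xs, ls) = ((x t, l t) - (xt t, lt t)) + ((xt t, lt t) - (xs, ls)) := by
        abel
      rw [this]
      exact norm_add_le _ _
    exact h1.trans (add_le_add (pairNorm_le_add _) le_rfl)
  · obtain ⟨h1, h2, h3, h4⟩ := low hs
    have hu := isBigO_one_div_rpow_half_of_sq h2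
    rw [mul_div_cancel_left₀ _ (two_ne_zero' ℝ)] at hu
    have hA := res hu
    refine ⟨h2, h3, h4, hA, fun hs' => ?_⟩
    rw [show 2 * (1 + s - p) + s = 3 * s - 2 * p + 2 by ring] at h1
    obtain ⟨i1, i2⟩ := isBigO_one_div_rpow_add p (3 * s - 2 * p + 2)
    -- Below the threshold 3s - 2p + 2 ≤ 1 + s - p, so the residual is no worse than the gap.
    exact ⟨h1, lag (h1.trans i2) (hA.trans
      (i1.add ((isBigO_one_div_rpow (by linarith)).trans i2))) i1⟩
  · subst hr
    obtain ⟨h1, h2, h3, h4⟩ := high hs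
    have hA := res (isBigO_one_div_rpow_half_of_sq h2)
    rw [show 1 - s - max 0 (p - s) + s = 1 - max 0 (p - s) by ring] at h1
    obtain ⟨i1, i2⟩ := isBigO_one_div_rpow_add p ((1 - s - max 0 (p - s)) / 2)
    -- This amounts to (1 - s - r)/2 ≤ 1 - r: here the residual, not the gap, limits the rate.
    have hr : max 0 (p - s) ≤ 1 + s := max_le (by linarith) (by linarith)
    obtain ⟨j1, j2⟩ := lag (h1.trans ((isBigO_one_div_rpow (by linarith)).trans i2)) hA i1
    exact ⟨h1, h2, h3, h4, j1, j2, hA⟩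
  · obtain ⟨h1, -, -, -⟩ := high (by linarith)
    have hr : max 0 (p - s) ≤ 1 - s := max_le (by linarith) (by linarith)
    -- The multiplier is eventually bounded, since it approaches the bounded path; this is what the
    -- sharper residual estimate requires.
    have hlb : ∀ᶠ t in atTop, ‖l t‖ ≤ R + 1 := by
      filter_upwards [dist_zero.2.eventually (gt_mem_nhds one_pos), eventually_ge_atTop t₀]
        with t h h0
      have h5 := norm_add_le (l t - lt t) (lt t)
      rw [sub_add_cancel] at h5
      linarith [hmR t h0]
    have hA := hsol.isBigO_residual_of_bounded hθ0 hc hs hsp ht₀ hlb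
    obtain ⟨j1, j2⟩ := lag (h1.trans (isBigO_one_div_rpow (by linarith))) hA
      (isBigO_one_div_rpow hsp)
    exact ⟨j1, j2, hA⟩
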